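/- Let $q$ be a prime power, let $m\ge 4$, and let $V$ be an $m$-dimensional vector space over $\mathbb F_{q^2}$ equipped with a non-degenerate Hermitian form $\eta$ (with respect to the involution $x\mapsto x^q$). Let $\mathbb H_{m,2}$ be the set of points $[v_1\wedge v_2]$ of $\mathrm{PG}(\bigwedge^2 V)$, where $\langle v_1,v_2\rangle$ ranges over the totally $\eta$-isotropic $2$-dimensional subspaces of $V$ (the totally isotropic lines of $\mathrm{PG}(V)$). Choose vector representatives $\omega_1,\dots,\omega_N$ of the points of $\mathbb H_{m,2}$, one for each point, in any order. The line Hermitian Grassmann code $$\mathcal C(\mathbb H_{m,2})=\{(\varphi(\omega_1),\dots,\varphi(\omega_N)) : \varphi\in(\textstyle\bigwedge^2V)^*\}\subseteq\mathbb F_{q^2}^N$$ is an $[N,K,d_{\min}]$-linear code over $\mathbb F_{q^2}$, where $N$ is the number of totally $\eta$-isotropic lines of $\mathrm{PG}(V)$, $$N=\frac{(q^m+(-1)^{m-1})(q^{m-1}-(-1)^{m-1})(q^{m-2}+(-1)^{m-3})(q^{m-3}-(-1)^{m-3})}{(q^2-1)^2(q^2+1)},\qquad K=\binom m2,$$ and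 $$d_{\min}=\begin{cases} q^{4m-12}-q^{2m-6} & \text{if } m=4 \text{ or } m=6,\\ q^{4m-12} & \text{if } m\ge 8 \text{ is even},\\ q^{4m-12}-q^{3m-9} & \text{if } m \text{ is odd.}\end{cases}$$ -/

import Mathlib

open Module
open scoped LinearAlgebra.Projectivization

namespace HermitianGrassmann

section Pluecker

variable {F V : Type*} [Field F] [AddCommGroup V] [Module F V] [FiniteDimensional F V]

/-- The image of `⋀^k X` in `⋀^k V` is one-dimensional when `dim X = k`. -/
theorem finrank_range_map_subtype {k : ℕ} (X : Submodule F V) (hX : finrank F X = k) :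
    finrank F (LinearMap.range (exteriorPower.map k X.subtype)) = 1 := by
  rw [LinearMap.finrank_range_of_inj
    (exteriorPower.map_injective_field (Submodule.subtype_injective X)),
    exteriorPower.finrank_eq, hX, Nat.choose_self]

/-- The Plücker embedding `e_k`: it sends a `k`-dimensional subspace `X = ⟨v₁, …, v_k⟩` of `V` to
the point `[v₁ ∧ ⋯ ∧ v_k]` of `PG(⋀^k V)`, which is the line `⋀^k X ⊆ ⋀^k V`. -/
noncomputable def pluecker (k : ℕ) (X : {X : Submodule F V // finrank F X = k}) :
    ℙ F (⋀[F]^k V) :=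
  Projectivization.mk'' (LinearMap.range (exteriorPower.map k X.1.subtype))
    (finrank_range_map_subtype X.1 X.2)

/-- For every basis `b` of `X`, the Plücker point of `X` is spanned by `b₁ ∧ ⋯ ∧ b_k`. -/
theorem pluecker_submodule (k : ℕ) (X : {X : Submodule F V // finrank F X = k})
    (b : Basis (Fin k) F X.1) :
    (pluecker k X).submodule =
      Submodule.span F {exteriorPower.ιMulti F k (fun i => (b i : V))} := by
  have h0 : exteriorPower.ιMulti F k b ≠ 0 := fun h => by
    have h1 := exteriorPower.alternatingMapLinearEquiv_apply_ιMulti b.det b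
    rw [h, map_zero, b.det_self] at h1
    exact zero_ne_one h1
  have h1 : finrank F (⋀[F]^k X.1) = 1 := by
    rw [exteriorPower.finrank_eq, X.2, Nat.choose_self]
  rw [pluecker, Projectivization.submodule_mk'', LinearMap.range_eq_map,
    ← (finrank_eq_one_iff_of_nonzero _ h0).1 h1, Submodule.map_span, Set.image_singleton,
    exteriorPower.map_apply_ιMulti]
  rfl

end Pluecker

section Hermitian

variable {F V : Type*} [Field F] [AddCommGroup V] [Module F V] [FiniteDimensional F V]
variable {σ : F →+* F}

/-- The points of the line Hermitian Grassmannian: the totally `η`-isotropic lines of `PG(V)`,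
that is, the `2`-dimensional subspaces of `V` on which `η` vanishes identically. -/
def isotropicLines (η : V →ₛₗ[σ] V →ₗ[F] F) : Set {X : Submodule F V // finrank F X = 2} :=
  {X | ∀ x ∈ X.1, ∀ y ∈ X.1, η x y = 0}

/-- The image of the line Hermitian Grassmannian under the Plücker embedding. -/
def hermitianLineVariety (η : V →ₛₗ[σ] V →ₗ[F] F) : Set (ℙ F (⋀[F]^2 V)) :=
  pluecker 2 '' isotropicLines η

end Hermitian

section Codes

variable {F W : Type*} [Field F] [AddCommGroup W] [Module F W] {N : ℕ}

/-- `ω₁, …, ω_N` are vector representatives of the points of `Ω`, each point of `Ω` being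
represented exactly once. -/
structure IsRepresentativeSystem (Ω : Set (ℙ F W)) (ω : Fin N → W) : Prop where
  ne_zero : ∀ i, ω i ≠ 0
  bijOn : Set.BijOn (fun i => Projectivization.mk F (ω i) (ne_zero i)) Set.univ Ω

/-- The projective code with columns `ω₁, …, ω_N`: its words are `(φ(ω₁), …, φ(ω_N))` for `φ` in
the dual space of `W`. In coordinates with respect to a basis of `W`, this is the row space of the
matrix whose columns are `ω₁, …, ω_N`. -/
def projectiveCode (ω : Fin N → W) : Submodule F (Fin N → F) :=
  LinearMap.range (LinearMap.pi fun i => Dual.eval F W (ω i))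

/-- `d` is the minimum Hamming distance between two distinct words of `C`. -/
def IsMinimumDistance [DecidableEq F] (C : Submodule F (Fin N → F)) (d : ℕ) : Prop :=
  IsLeast {n | ∃ x ∈ C, ∃ y ∈ C, x ≠ y ∧ hammingDist x y = n} d

end Codes

end HermitianGrassmann

/-!
An alternating form on `V` can be written `(u, v) ↦ η (f u) v` with `f` semilinear with respect
to the involution. Counting ordered bases of totally isotropic lines, the weight of the codeword
of `f`, times `(q⁴ - 1)(q⁴ - q²)`, is the number of pairs of orthogonal isotropic vectors `u, v`
with `η (f u) v ≠ 0`. For fixed isotropic `u` the number of such `v` is a difference between the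
numbers of isotropic vectors of `u^⊥` and of `⟨u, f u⟩^⊥`: it vanishes when `f u ∈ ⟨u⟩`, and
otherwise only depends on whether `f u` is isotropic. So the weight is determined by the number of
isotropic eigenvectors of `f` and the number of isotropic `u` with `f u` anisotropic.

For `c ≠ 0` the set `{u | f u = c u}` is a vector space over the fixed field, of order `q`, so it
has at most `q ^ dim V` elements, and only `q + 1` values of `c` can occur when `f ∘ f` is scalar.
Together with the evenness of the rank of `f` this bounds the number of eigenvectors. The minimum
is attained by a form of rank two, except that for `m = 4` and `m = 6` a nondegenerate form with
`f ∘ f = -1` has smaller weight.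
-/

namespace HermitianGrassmann

section Counting

theorem ncard_setOf_prod_eq_sum {α β : Type*} [Fintype α] [Finite β] (r : α → β → Prop) :
    {p : α × β | r p.1 p.2}.ncard = ∑ a, {b | r a b}.ncard := by
  classical
  have := Fintype.ofFinite β
  simp_rw [← Nat.card_coe_set_eq]
  rw [← Nat.card_sigma]
  exact Nat.card_congr
    { toFun := fun p => ⟨p.1.1, p.1.2, p.2⟩
      invFun := fun p => ⟨(p.1, p.2.1), p.2.2⟩
      left_inv := fun _ => rfl
      right_inv := fun _ => rfl }

theorem ncard_setOf_prod_eq_of_indicator {α β : Type*} [Finite α] [Finite β] {r : α → β → Prop}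
    {S T : Set α} {c d : ℤ} (hr : ∀ a, ({b | r a b}.ncard : ℤ) =
      S.indicator (fun _ => c) a + T.indicator (fun _ => d) a) :
    ({p : α × β | r p.1 p.2}.ncard : ℤ) = S.ncard * c + T.ncard * d := by
  classical
  have := Fintype.ofFinite α
  have hsum (S : Set α) (c : ℤ) : ∑ a, S.indicator (fun _ => c) a = S.ncard * c := by
    simp_rw [Set.indicator_apply]
    rw [← Finset.sum_filter, Finset.sum_const, nsmul_eq_mul, Set.ncard_eq_toFinset_card',
      Set.filter_mem_univ_eq_toFinset]
  rw [ncard_setOf_prod_eq_sum, Nat.cast_sum, Finset.sum_congr rfl fun a _ => hr a,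
    Finset.sum_add_distrib, hsum, hsum]

theorem ncard_setOf_prod_eq_mul {α β : Type*} [Finite α] [Finite β] {r : α → β → Prop}
    {S : Set α} {c : ℤ} (hS : ∀ a b, r a b → a ∈ S)
    (hc : ∀ a ∈ S, ({b | r a b}.ncard : ℤ) = c) :
    ({p : α × β | r p.1 p.2}.ncard : ℤ) = S.ncard * c := by
  rw [ncard_setOf_prod_eq_of_indicator (S := S) (T := ∅) (c := c) (d := 0) fun a => ?_,
    mul_zero, add_zero]
  by_cases ha : a ∈ S
  · simp [ha, hc a ha]
  · simp [ha, mt (hS a _) ha]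

theorem ncard_setOf_pow_eq {G : Type*} [CommGroup G] [IsCyclic G] [Finite G] {d e : ℕ}
    (hG : Nat.card G = d * e) {t : G} (ht : t ^ e = 1) : {a : G | a ^ d = t}.ncard = d := by
  have he : 0 < e := Nat.pos_of_mul_pos_left (hG ▸ Nat.card_pos)
  obtain ⟨a₀, rfl⟩ : ∃ a₀ : G, a₀ ^ d = t := by
    obtain ⟨g, hg⟩ := IsCyclic.exists_monoid_generator (α := G)
    obtain ⟨k, rfl⟩ := hg t
    have hk : d * e ∣ k * e := by
      rw [← hG, ← orderOf_eq_card_of_forall_mem_powers hg]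
      exact orderOf_dvd_of_pow_eq_one (by rw [pow_mul, ht])
    obtain ⟨l, rfl⟩ := Nat.dvd_of_mul_dvd_mul_right he hk
    exact ⟨g ^ l, by rw [← pow_mul, mul_comm]⟩
  have hcoset : {a : G | a ^ d = a₀ ^ d} = (a₀ * ·) '' ((powMonoidHom d : G →* G).ker : Set G) := by
    ext a
    simp [mul_pow, inv_mul_eq_one, eq_comm]
  rw [hcoset, Set.ncard_image_of_injective _ (mul_right_injective a₀), ← Nat.card_coe_set_eq,
    SetLike.coe_sort_coe, IsCyclic.card_powMonoidHom_ker, hG, Nat.gcd_mul_right_left]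

end Counting

section Field

variable {F : Type*} [Field F]

/-- `σ` is the involution `x ↦ x ^ q` of a field with `q ^ 2` elements. -/
class IsFrobeniusInvolution (q : outParam ℕ) (σ : F →+* F) : Prop where
  natCard_eq : Nat.card F = q ^ 2
  apply_eq_pow (x : F) : σ x = x ^ q

namespace IsFrobeniusInvolution

variable {q : ℕ}

theorem finite (σ : F →+* F) [IsFrobeniusInvolution q σ] : Finite F := by
  have hq : q ≠ 0 := by
    rintro rfl
    simpa using apply_eq_pow (σ := σ) 0
  exact Nat.finite_of_card_ne_zero (by rw [natCard_eq (σ := σ)]; positivity)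

theorem two_le (σ : F →+* F) [IsFrobeniusInvolution q σ] : 2 ≤ q := by
  have := finite σ
  have h : 1 < q ^ 2 := natCard_eq (σ := σ) ▸ Finite.one_lt_card
  exact (one_lt_pow_iff_of_nonneg q.zero_le two_ne_zero).1 h

instance ringHomInvPair (σ : F →+* F) [IsFrobeniusInvolution q σ] : RingHomInvPair σ σ := by
  have h : σ.comp σ = RingHom.id F := by
    have := finite σ
    have := Fintype.ofFinite F
    ext x
    rw [RingHom.comp_apply, apply_eq_pow, apply_eq_pow, ← pow_mul, ← sq,
      ← natCard_eq (σ := σ), Nat.card_eq_fintype_card, FiniteField.pow_card, RingHom.id_apply]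
  exact ⟨h, h⟩

theorem natCard_units (σ : F →+* F) [IsFrobeniusInvolution q σ] :
    Nat.card Fˣ = (q + 1) * (q - 1) := by
  rw [Nat.card_units, natCard_eq (σ := σ), ← Nat.sq_sub_sq, one_pow]

theorem exists_apply_ne (σ : F →+* F) [IsFrobeniusInvolution q σ] : ∃ a, σ a ≠ a := by
  by_contra! hσ
  have := finite σ
  have hq := two_le σ
  obtain ⟨g, hg⟩ := IsCyclic.exists_generator (α := Fˣ)
  have hord : orderOf g = (q + 1) * (q - 1) := by
    rw [orderOf_eq_card_of_forall_mem_zpowers hg, natCard_units σ]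
  have hpow : g ^ (q - 1) = 1 := by
    have h : g ^ (q - 1) * g = g := by
      rw [← pow_succ, Nat.sub_add_cancel (by lia)]
      ext
      rw [Units.val_pow_eq_pow_val, ← apply_eq_pow (σ := σ), hσ]
    simpa using h
  have := Nat.le_of_dvd (by lia) (orderOf_dvd_of_pow_eq_one hpow)
  rw [hord] at this
  nlinarith [Nat.sub_add_cancel (one_le_two.trans hq)]

theorem ncard_setOf_mul_eq_le (σ : F →+* F) [IsFrobeniusInvolution q σ] (t : F) :
    {a : F | σ a * a = t}.ncard ≤ q + 1 := by
  classical
  have hroots : {a : F | σ a * a = t} ⊆ (Polynomial.nthRoots (q + 1) t).toFinset := fun a ha => by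
    rw [Set.mem_ofPred_eq, apply_eq_pow, ← pow_succ] at ha
    rwa [Finset.mem_coe, Multiset.mem_toFinset, Polynomial.mem_nthRoots q.succ_pos]
  refine (Set.ncard_le_ncard hroots).trans ?_
  rw [Set.ncard_coe_finset]
  exact (Multiset.toFinset_card_le _).trans (Polynomial.card_nthRoots _ _)

theorem ncard_setOf_mul_eq {σ : F →+* F} [IsFrobeniusInvolution q σ] {t : F} (ht : t ≠ 0)
    (hσt : σ t = t) :
    {a : F | σ a * a = t}.ncard = q + 1 := by
  have := finite σ
  have hq := two_le σ
  have hpow : Units.mk0 t ht ^ (q - 1) = 1 := by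
    have h : Units.mk0 t ht ^ (q - 1) * Units.mk0 t ht = Units.mk0 t ht := by
      rw [← pow_succ, Nat.sub_add_cancel (by lia)]
      ext
      rw [Units.val_pow_eq_pow_val, Units.val_mk0, ← apply_eq_pow (σ := σ), hσt]
    simpa using h
  have himage : {a : F | σ a * a = t} = Units.val '' {a : Fˣ | a ^ (q + 1) = Units.mk0 t ht} := by
    ext a
    simp only [Set.mem_ofPred_eq, Set.mem_image, apply_eq_pow, ← pow_succ]
    constructor
    · intro ha
      have ha₀ : a ≠ 0 := by rintro rfl; exact ht (by simpa using ha.symm)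
      exact ⟨Units.mk0 a ha₀, Units.ext (by simpa using ha), rfl⟩
    · rintro ⟨u, hu, rfl⟩
      rw [← Units.val_pow_eq_pow_val, hu, Units.val_mk0]
  rw [himage, Set.ncard_image_of_injective _ Units.val_injective,
    ncard_setOf_pow_eq (natCard_units σ) hpow]

theorem ncard_submodule {V : Type*} [AddCommGroup V] [Module F V] [FiniteDimensional F V]
    (σ : F →+* F) [IsFrobeniusInvolution q σ] (W : Submodule F V) :
    (W : Set V).ncard = q ^ (2 * finrank F W) := by
  rw [← Nat.card_coe_set_eq, SetLike.coe_sort_coe, Module.natCard_eq_pow_finrank (K := F),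
    natCard_eq (σ := σ), pow_mul]

end IsFrobeniusInvolution

end Field

section Radical

variable {F V : Type*} [Field F] [AddCommGroup V] [Module F V] {σ : F →+* F}

theorem finrank_inf_ker_add_one [FiniteDimensional F V] {W : Submodule F V} {φ : Dual F V} {w : V}
    (hw : w ∈ W) (hφ : φ w ≠ 0) :
    finrank F (W ⊓ LinearMap.ker φ : Submodule F V) + 1 = finrank F W := by
  have hker : (LinearMap.ker (φ.domRestrict W)).map W.subtype = W ⊓ LinearMap.ker φ := by
    ext x
    simp [and_comm]
  rw [← hker, Submodule.finrank_map_subtype_eq]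
  exact Dual.finrank_ker_add_one_of_ne_zero fun h => hφ (LinearMap.congr_fun h ⟨w, hw⟩)

/-- The radical of the restriction of the form `B` to the subspace `W`. -/
def radical (B : V →ₛₗ[σ] V →ₗ[F] F) (W : Submodule F V) : Submodule F V :=
  W ⊓ W.orthogonalBilin B

theorem mem_radical {B : V →ₛₗ[σ] V →ₗ[F] F} {W : Submodule F V} {x : V} :
    x ∈ radical B W ↔ x ∈ W ∧ ∀ y ∈ W, B y x = 0 :=
  Iff.rfl

theorem radical_eq_self {B : V →ₛₗ[σ] V →ₗ[F] F} {W : Submodule F V} :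
    radical B W = W ↔ ∀ x ∈ W, ∀ y ∈ W, B x y = 0 :=
  inf_eq_left.trans ⟨fun h x hx _ hy => h hy x hx, fun h _ hx y hy => h y hy _ hx⟩

theorem radical_inf_ker {B : V →ₛₗ[σ] V →ₗ[F] F} (hB : B.IsRefl) {W : Submodule F V} {w : V}
    (hw : w ∈ W) (hww : B w w ≠ 0) : radical B (W ⊓ LinearMap.ker (B w)) = radical B W := by
  ext v
  simp only [mem_radical, Submodule.mem_inf, LinearMap.mem_ker]
  refine ⟨fun ⟨⟨hv, hwv⟩, h⟩ => ⟨hv, fun x hx => hB _ _ ?_⟩,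
    fun ⟨hv, h⟩ => ⟨⟨hv, h w hw⟩, fun x hx => h x hx.1⟩⟩
  have hproj : B w (x - (B w x / B w w) • w) = 0 := by
    rw [map_sub, map_smul, smul_eq_mul, div_mul_cancel₀ _ hww, sub_self]
  have := hB _ _ (h _ ⟨W.sub_mem hx (W.smul_mem _ hw), hproj⟩)
  rwa [map_sub, map_smul, hB _ _ hwv, smul_zero, sub_zero] at this

theorem finrank_inf_ker_inf_ker_add_two [FiniteDimensional F V] {B : V →ₗ[F] V →ₗ[F] F}
    (hB : B.IsAlt) {W : Submodule F V} {a b : V} (ha : a ∈ W) (hb : b ∈ W) (hab : B a b ≠ 0) :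
    finrank F (W ⊓ LinearMap.ker (B a) ⊓ LinearMap.ker (B b) : Submodule F V) + 2 =
      finrank F W := by
  have hba : B b a ≠ 0 := mt (hB.isRefl b a) hab
  have ha' : a ∈ W ⊓ LinearMap.ker (B a) := ⟨ha, hB a⟩
  rw [← finrank_inf_ker_add_one hb hab, ← finrank_inf_ker_add_one ha' hba]

theorem radical_inf_ker_inf_ker {B : V →ₗ[F] V →ₗ[F] F} (hB : B.IsAlt) {W : Submodule F V}
    {a b : V} (ha : a ∈ W) (hb : b ∈ W) (hab : B a b ≠ 0) :
    radical B (W ⊓ LinearMap.ker (B a) ⊓ LinearMap.ker (B b)) = radical B W := by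
  ext v
  simp only [mem_radical, Submodule.mem_inf, LinearMap.mem_ker]
  refine ⟨fun ⟨⟨⟨hv, hav⟩, hbv⟩, h⟩ => ⟨hv, fun x hx => hB.isRefl _ _ ?_⟩,
    fun ⟨hv, h⟩ => ⟨⟨⟨hv, h a ha⟩, h b hb⟩, fun x hx => h x hx.1.1⟩⟩
  set y := x + (B b x / B a b) • a - (B a x / B a b) • b with hy
  have hya : B a y = 0 := by simp [hy, hB a, hab]
  have hyb : B b y = 0 := by simp [hy, hB b, ← hB.neg a b, hab]
  have hyW : y ∈ W := W.sub_mem (W.add_mem hx (W.smul_mem _ ha)) (W.smul_mem _ hb)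
  have := hB.isRefl _ _ (h y ⟨⟨hyW, hya⟩, hyb⟩)
  rwa [hy, map_sub, map_add, map_smul, map_smul, hB.isRefl _ _ hav, hB.isRefl _ _ hbv, smul_zero,
    smul_zero, add_zero, sub_zero] at this

theorem even_finrank_add_finrank_radical [FiniteDimensional F V] {B : V →ₗ[F] V →ₗ[F] F}
    (hB : B.IsAlt) (W : Submodule F V) : Even (finrank F W + finrank F (radical B W)) := by
  induction hn : finrank F W using Nat.strong_induction_on generalizing W with
  | _ n ih =>
    by_cases h0 : ∀ x ∈ W, ∀ y ∈ W, B x y = 0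
    · rw [radical_eq_self.2 h0, hn]
      exact ⟨n, rfl⟩
    · push Not at h0
      obtain ⟨a, ha, b, hb, hab⟩ := h0
      have hdim := finrank_inf_ker_inf_ker_add_two hB ha hb hab
      have heven := ih _ (by omega) (W ⊓ LinearMap.ker (B a) ⊓ LinearMap.ker (B b)) rfl
      rw [radical_inf_ker_inf_ker hB ha hb hab] at heven
      rw [← hn, ← hdim, add_right_comm]
      exact heven.add even_two

end Radical

section Orthogonal

variable {F V : Type*} [Field F] [AddCommGroup V] [Module F V] {σ : F →+* F}
  {η : V →ₛₗ[σ] V →ₗ[F] F}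

theorem mem_orthogonalBilin_span {s : Set V} {v : V} :
    v ∈ (Submodule.span F s).orthogonalBilin η ↔ ∀ x ∈ s, η x v = 0 := by
  refine ⟨fun hv x hx => hv x (Submodule.subset_span hx), fun hv x hx => ?_⟩
  induction hx using Submodule.span_induction with
  | mem x hx => exact hv x hx
  | zero => simp
  | add x y _ _ h₁ h₂ => rw [map_add, LinearMap.add_apply, h₁, h₂, add_zero]
  | smul a x _ h => rw [map_smulₛₗ, LinearMap.smul_apply, h, smul_zero]

theorem mem_orthogonalBilin_span_singleton {u v : V} :
    v ∈ (F ∙ u).orthogonalBilin η ↔ η u v = 0 := by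
  rw [mem_orthogonalBilin_span]
  simp

theorem mem_orthogonalBilin_span_pair {u w v : V} :
    v ∈ (Submodule.span F {u, w}).orthogonalBilin η ↔ η u v = 0 ∧ η w v = 0 := by
  rw [mem_orthogonalBilin_span]
  simp

theorem finrank_map_of_injective {W : Type*} [AddCommGroup W] [Module F W] [RingHomInvPair σ σ]
    {g : V →ₛₗ[σ] W} (hg : Function.Injective g) (S : Submodule F V) :
    finrank F (S.map g) = finrank F S := by
  let e := S.equivMapOfInjective g hg
  have hσ : Function.Bijective σ :=
    Function.bijective_iff_has_inverse.2
      ⟨σ, fun x => RingHomInvPair.comp_apply_eq, fun x => RingHomInvPair.comp_apply_eq⟩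
  have hrank := lift_rank_eq_of_equiv_equiv σ e.toAddEquiv hσ fun r x => e.map_smulₛₗ r x
  simpa [finrank] using (congrArg Cardinal.toNat hrank).symm

variable [FiniteDimensional F V]

theorem finrank_add_finrank_orthogonalBilin [RingHomInvPair σ σ] (hη : η.SeparatingLeft)
    (W : Submodule F V) : finrank F W + finrank F (W.orthogonalBilin η) = finrank F V := by
  have hinj : Function.Injective η :=
    LinearMap.ker_eq_bot.1 (LinearMap.separatingLeft_iff_ker_eq_bot.1 hη)
  have hperp : W.orthogonalBilin η = (W.map η).dualCoannihilator := by
    ext v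
    simp [Submodule.mem_dualCoannihilator]
  rw [hperp, ← finrank_map_of_injective hinj W]
  exact Subspace.finrank_add_finrank_dualCoannihilator_eq _

variable [RingHomInvPair σ σ]

theorem orthogonalBilin_orthogonalBilin (hη : η.SeparatingLeft) (hr : η.IsRefl)
    (W : Submodule F V) : (W.orthogonalBilin η).orthogonalBilin η = W := by
  have h₁ := finrank_add_finrank_orthogonalBilin hη W
  have h₂ := finrank_add_finrank_orthogonalBilin hη (W.orthogonalBilin η)
  exact (Submodule.eq_of_le_of_finrank_eq (W.le_orthogonalBilin_orthogonalBilin hr)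
    (by omega)).symm

theorem radical_orthogonalBilin (hη : η.SeparatingLeft) (hr : η.IsRefl) (W : Submodule F V) :
    radical η (W.orthogonalBilin η) = radical η W := by
  rw [radical, orthogonalBilin_orthogonalBilin hη hr, inf_comm, radical]

end Orthogonal

section Pair

variable {F V : Type*} [Field F] [AddCommGroup V] [Module F V]

theorem finrank_span_pair {a b : V} (hab : LinearIndependent F ![a, b]) :
    finrank F (Submodule.span F {a, b}) = 2 := by
  have := finrank_span_eq_card hab
  rwa [Matrix.range_cons_cons_empty, Fintype.card_fin] at this

theorem linearIndependent_pair_of_notMem {a b : V} (ha : a ≠ 0) (hb : b ∉ F ∙ a) :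
    LinearIndependent F ![a, b] :=
  (LinearIndependent.pair_iff' ha).2 fun c hc => hb (Submodule.mem_span_singleton.2 ⟨c, hc⟩)

theorem exists_notMem_span_singleton {X : Submodule F V} (hX : 2 ≤ finrank F X) (u : V) :
    ∃ v ∈ X, v ∉ F ∙ u := by
  refine SetLike.not_le_iff_exists.1 fun hle => ?_
  have := Submodule.finrank_mono hle
  have := finrank_span_le_card (R := F) ({u} : Set V)
  simp at this
  lia

theorem exists_linearIndependent_pair_mem {X : Submodule F V} (hX : 2 ≤ finrank F X) :
    ∃ u ∈ X, ∃ v ∈ X, LinearIndependent F ![u, v] := by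
  obtain ⟨u, hu, hu₀⟩ := exists_notMem_span_singleton hX 0
  obtain ⟨v, hv, hvu⟩ := exists_notMem_span_singleton hX u
  exact ⟨u, hu, v, hv, linearIndependent_pair_of_notMem (by simpa using hu₀) hvu⟩

variable {σ : F →+* F} {η : V →ₛₗ[σ] V →ₗ[F] F} {u w : V}

theorem linearIndependent_pair_of_anisotropic (hu : u ≠ 0) (hr : η.IsRefl) (huw : η u w = 0)
    (hww : η w w ≠ 0) : LinearIndependent F ![u, w] :=
  linearIndependent_pair_of_notMem hu fun h => hww <| by
    obtain ⟨c, rfl⟩ := Submodule.mem_span_singleton.1 h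
    rw [map_smul, hr _ _ huw, smul_zero]

theorem finrank_radical_span_singleton (hu : u ≠ 0) (huu : η u u = 0) :
    finrank F (radical η (F ∙ u)) = 1 := by
  rw [radical, inf_eq_left.2, finrank_span_singleton hu]
  rwa [Submodule.span_singleton_le_iff_mem, mem_orthogonalBilin_span_singleton]

theorem finrank_radical_span_pair_of_isotropic (hr : η.IsRefl) (huw : LinearIndependent F ![u, w])
    (huu : η u u = 0) (hww : η w w = 0) (h : η u w = 0) :
    finrank F (radical η (Submodule.span F {u, w})) = 2 := by
  rw [radical, inf_eq_left.2, finrank_span_pair huw]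
  rw [Submodule.span_le, Set.pair_subset_iff]
  exact ⟨mem_orthogonalBilin_span_pair.2 ⟨huu, hr _ _ h⟩, mem_orthogonalBilin_span_pair.2 ⟨h, hww⟩⟩

theorem finrank_radical_span_pair_of_anisotropic (hr : η.IsRefl) (hu : u ≠ 0) (huu : η u u = 0)
    (hww : η w w ≠ 0) (h : η u w = 0) :
    finrank F (radical η (Submodule.span F {u, w})) = 1 := by
  have hrad : radical η (Submodule.span F {u, w}) = F ∙ u := by
    ext x
    rw [radical, Submodule.mem_inf, mem_orthogonalBilin_span_pair, Submodule.mem_span_singleton,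
      Submodule.mem_span_pair]
    constructor
    · rintro ⟨⟨c, d, rfl⟩, -, hx⟩
      obtain rfl : d = 0 := by simpa [hr _ _ h, hww] using hx
      exact ⟨c, by simp⟩
    · rintro ⟨c, rfl⟩
      exact ⟨⟨c, 0, by simp⟩, by simp [huu], by simp [hr _ _ h]⟩
  rw [hrad, finrank_span_singleton hu]

end Pair

section Isotropic

variable {F V : Type*} [Field F] [AddCommGroup V] [Module F V] {σ : F →+* F}
  {η : V →ₛₗ[σ] V →ₗ[F] F}

/-- The isotropic vectors of a subspace. The zero vector is one of them, so that they are counted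
by polynomials in `q`. -/
def isotropicVectors (η : V →ₛₗ[σ] V →ₗ[F] F) (W : Submodule F V) : Set V :=
  {v | v ∈ W ∧ η v v = 0}

theorem isotropicVectors_bot : isotropicVectors η ⊥ = {0} := by
  ext x
  simp +contextual [isotropicVectors]

theorem isotropicVectors_subset (W : Submodule F V) : isotropicVectors η W ⊆ W :=
  fun _ hx => hx.1

theorem isotropicVectors_mono {W W' : Submodule F V} (h : W ≤ W') :
    isotropicVectors η W ⊆ isotropicVectors η W' :=
  fun _ hx => ⟨h hx.1, hx.2⟩

theorem isotropicVectors_eq_coe {W : Submodule F V} (hW : ∀ w ∈ W, η w w = 0) :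
    isotropicVectors η W = W :=
  (isotropicVectors_subset W).antisymm fun w hw => ⟨hw, hW w hw⟩

theorem apply_add_smul_self {w x : V} (hwx : η w x = 0) (hxw : η x w = 0) (c : F) :
    η (x + c • w) (x + c • w) = η x x + σ c * c * η w w := by
  simp only [map_add, map_smulₛₗ, LinearMap.add_apply, LinearMap.smul_apply, smul_eq_mul, hwx, hxw,
    RingHom.id_apply]
  ring

variable {q : ℕ}

theorem apply_eq_zero_of_forall_apply_self [IsFrobeniusInvolution q σ] {W : Submodule F V}
    (hW : ∀ w ∈ W, η w w = 0) {x y : V} (hx : x ∈ W) (hy : y ∈ W) : η x y = 0 := by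
  obtain ⟨a, ha⟩ := IsFrobeniusInvolution.exists_apply_ne σ
  have hpol (b : F) : b * η x y + σ b * η y x = 0 := by
    have := hW (x + b • y) (W.add_mem hx (W.smul_mem b hy))
    simp only [map_add, map_smulₛₗ, LinearMap.add_apply, LinearMap.smul_apply, smul_eq_mul,
      hW x hx, hW y hy, mul_zero, zero_add, add_zero, RingHom.id_apply] at this
    linear_combination this
  have h1 := hpol 1
  rw [map_one] at h1
  have ha' : (a - σ a) * η x y = 0 := by linear_combination hpol a - σ a * h1
  exact (mul_eq_zero.1 ha').resolve_left (sub_ne_zero.2 ha.symm)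

theorem ncard_isotropicVectors_eq_ncard_pairs (hη : η.IsSymm) {W : Submodule F V} {w : V}
    (hw : w ∈ W) (hww : η w w ≠ 0) :
    (isotropicVectors η W).ncard = {p : V × F | p.1 ∈ W ⊓ LinearMap.ker (η w) ∧
      η p.1 p.1 + σ p.2 * p.2 * η w w = 0}.ncard := by
  have hker {x : V} (hx : x ∈ W ⊓ LinearMap.ker (η w)) : η w x = 0 := hx.2
  refine (Set.BijOn.ncard_eq (f := fun p : V × F => p.1 + p.2 • w) ⟨?_, ?_, ?_⟩).symm
  · rintro ⟨x, c⟩ ⟨hx, hxc⟩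
    refine ⟨W.add_mem hx.1 (W.smul_mem c hw), ?_⟩
    rwa [apply_add_smul_self (hker hx) (hη.isRefl _ _ (hker hx))]
  · rintro ⟨x, c⟩ ⟨hx, -⟩ ⟨y, d⟩ ⟨hy, -⟩ (hxy : x + c • w = y + d • w)
    have hcd := congrArg (η w) hxy
    simp only [map_add, map_smul, hker hx, hker hy, zero_add, smul_eq_mul] at hcd
    obtain rfl := mul_right_cancel₀ hww hcd
    rw [add_right_cancel hxy]
  · rintro v ⟨hv, hvv⟩
    have hdec : v - (η w v / η w w) • w + (η w v / η w w) • w = v := sub_add_cancel _ _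
    have hx : v - (η w v / η w w) • w ∈ W ⊓ LinearMap.ker (η w) :=
      ⟨W.sub_mem hv (W.smul_mem _ hw), by simp [hww]⟩
    refine ⟨(v - (η w v / η w w) • w, η w v / η w w), ⟨hx, ?_⟩, hdec⟩
    rw [← apply_add_smul_self (hker hx) (hη.isRefl _ _ (hker hx)), hdec, hvv]

variable [Finite V] [IsFrobeniusInvolution q σ]

theorem ncard_isotropicVectors_add_mul (hη : η.IsSymm) {W : Submodule F V} {w : V}
    (hw : w ∈ W) (hww : η w w ≠ 0) :
    ((isotropicVectors η W).ncard : ℤ) +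
        q * (isotropicVectors η (W ⊓ LinearMap.ker (η w))).ncard =
      (q + 1) * q ^ (2 * finrank F (W ⊓ LinearMap.ker (η w) : Submodule F V)) := by
  classical
  have := IsFrobeniusInvolution.finite σ
  set W' := W ⊓ LinearMap.ker (η w)
  have hfib (x : V) : ({c : F | x ∈ W' ∧ η x x + σ c * c * η w w = 0}.ncard : ℤ) =
      (W' : Set V).indicator (fun _ => (q + 1 : ℤ)) x +
        (isotropicVectors η W').indicator (fun _ => (-q : ℤ)) x := by
    by_cases hx : x ∈ W'
    swap
    · simp [hx, isotropicVectors]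
    by_cases hxx : η x x = 0
    · simp [hx, hxx, isotropicVectors, hww]
    · have hset : {c : F | x ∈ W' ∧ η x x + σ c * c * η w w = 0} =
          {c : F | σ c * c = -η x x / η w w} := by
        ext c
        simp only [hx, true_and, Set.mem_ofPred_eq, eq_div_iff hww, eq_neg_iff_add_eq_zero,
          add_comm]
      rw [hset, IsFrobeniusInvolution.ncard_setOf_mul_eq
        (div_ne_zero (neg_ne_zero.2 hxx) hww) (by rw [map_div₀, map_neg, hη.eq, hη.eq])]
      simp [hx, hxx, isotropicVectors]
  rw [ncard_isotropicVectors_eq_ncard_pairs hη hw hww, ncard_setOf_prod_eq_of_indicator hfib,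
    IsFrobeniusInvolution.ncard_submodule σ]
  push_cast
  ring

theorem mul_ncard_isotropicVectors (hη : η.IsSymm) (W : Submodule F V) :
    (q : ℤ) * (isotropicVectors η W).ncard = q ^ (2 * finrank F W) +
      (-1) ^ (finrank F W + finrank F (radical η W)) * (q - 1) *
        q ^ (finrank F W + finrank F (radical η W)) := by
  induction hn : finrank F W generalizing W with
  | zero =>
    rw [Submodule.finrank_eq_zero.1 hn, radical, bot_inf_eq, finrank_bot, isotropicVectors_bot,
      Set.ncard_singleton]
    simp
  | succ n ih =>
    by_cases hiso : ∀ w ∈ W, η w w = 0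
    · rw [radical_eq_self.2 fun _ hx _ hy => apply_eq_zero_of_forall_apply_self hiso hx hy,
        isotropicVectors_eq_coe hiso, IsFrobeniusInvolution.ncard_submodule σ, hn,
        (Even.add_self _).neg_one_pow]
      push_cast
      ring
    · push Not at hiso
      obtain ⟨w, hw, hww⟩ := hiso
      have hdim : finrank F (W ⊓ LinearMap.ker (η w) : Submodule F V) = n := by
        have := finrank_inf_ker_add_one hw hww
        omega
      have hsplit := ncard_isotropicVectors_add_mul hη hw hww
      have hih := ih _ hdim
      rw [radical_inf_ker hη.isRefl hw hww] at hih
      rw [hdim] at hsplit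
      ring_nf at hih hsplit ⊢
      linear_combination (q : ℤ) * hsplit - q * hih

theorem ncard_isotropicVectors {W : Submodule F V} (hη : η.IsSymm) {d ρ : ℕ}
    (hW : finrank F W = d + 1) (hρ : finrank F (radical η W) = ρ) :
    ((isotropicVectors η W).ncard : ℤ) =
      q ^ (2 * d + 1) - (-1) ^ (d + ρ) * (q - 1) * q ^ (d + ρ) := by
  have hq : (q : ℤ) ≠ 0 := mod_cast (zero_lt_two.trans_le (IsFrobeniusInvolution.two_le σ)).ne'
  apply mul_left_cancel₀ hq
  rw [mul_ncard_isotropicVectors hη, hW, hρ]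
  ring

theorem ncard_isotropicVectors_orthogonalBilin (hη : η.IsSymm) (hnd : η.SeparatingLeft)
    {S : Submodule F V} {d ρ : ℕ} (hV : finrank F V = d + 1 + finrank F S)
    (hρ : finrank F (radical η S) = ρ) :
    ((isotropicVectors η (S.orthogonalBilin η)).ncard : ℤ) =
      q ^ (2 * d + 1) - (-1) ^ (d + ρ) * (q - 1) * q ^ (d + ρ) := by
  refine ncard_isotropicVectors hη ?_ (radical_orthogonalBilin hnd hη.isRefl S ▸ hρ)
  have := finrank_add_finrank_orthogonalBilin hnd S
  omega

theorem ncard_isotropicVectors_top (hη : η.IsSymm) (hnd : η.SeparatingLeft) {d : ℕ}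
    (hV : finrank F V = d + 1) :
    ((isotropicVectors η ⊤).ncard : ℤ) = q ^ (2 * d + 1) - (-1) ^ d * (q - 1) * q ^ d := by
  have hρ : finrank F (radical η ⊤) = 0 := by
    have := finrank_add_finrank_orthogonalBilin hnd ⊤
    rw [finrank_top] at this
    rw [radical, top_inf_eq]
    omega
  exact ncard_isotropicVectors hη (by rw [finrank_top, hV]) hρ

theorem ncard_isotropicVectors_orthogonalBilin_singleton (hη : η.IsSymm) (hnd : η.SeparatingLeft)
    {d : ℕ} (hV : finrank F V = d + 2) {u : V} (hu : u ≠ 0) (huu : η u u = 0) :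
    ((isotropicVectors η ((F ∙ u).orthogonalBilin η)).ncard : ℤ) =
      q ^ (2 * d + 1) + (-1) ^ d * (q - 1) * q ^ (d + 1) := by
  rw [ncard_isotropicVectors_orthogonalBilin hη hnd (by rw [hV, finrank_span_singleton hu])
    (finrank_radical_span_singleton hu huu)]
  ring

end Isotropic

section SemilinearMap

variable {F V : Type*} [Field F] [AddCommGroup V] [Module F V] {σ : F →+* F}
  {η : V →ₛₗ[σ] V →ₗ[F] F} {f : V →ₛₗ[σ] V}

/-- The isotropic vectors `u` with `f u` a multiple of `u`, that is, those for which the vectors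
orthogonal to `u` are all annihilated by `η (f u)`. -/
def eigenVectors (η : V →ₛₗ[σ] V →ₗ[F] F) (f : V →ₛₗ[σ] V) : Set V :=
  {u | η u u = 0 ∧ ∃ c : F, f u = c • u}

/-- The isotropic vectors with anisotropic image under `f`. -/
def escapingVectors (η : V →ₛₗ[σ] V →ₗ[F] F) (f : V →ₛₗ[σ] V) : Set V :=
  {u | η u u = 0 ∧ η (f u) (f u) ≠ 0}

/-- The pairs `(u, v)` spanning a totally isotropic subspace with `η (f u) v ≠ 0`. When `η (f u) v`
is alternating in `u` and `v`, these are the ordered bases of the totally isotropic lines on which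
it does not vanish. -/
def activePairs (η : V →ₛₗ[σ] V →ₗ[F] F) (f : V →ₛₗ[σ] V) : Set (V × V) :=
  {p | η p.1 p.1 = 0 ∧ η p.2 p.2 = 0 ∧ η p.1 p.2 = 0 ∧ η (f p.1) p.2 ≠ 0}

theorem zero_mem_eigenVectors : (0 : V) ∈ eigenVectors η f :=
  ⟨by simp, 0, by simp⟩

theorem eigenVectors_subset : eigenVectors η f ⊆ isotropicVectors η ⊤ :=
  fun _ hu => ⟨trivial, hu.1⟩

theorem escapingVectors_subset : escapingVectors η f ⊆ isotropicVectors η ⊤ :=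
  fun _ hu => ⟨trivial, hu.1⟩

theorem disjoint_escapingVectors_eigenVectors :
    Disjoint (escapingVectors η f) (eigenVectors η f) := by
  rw [Set.disjoint_left]
  rintro u ⟨huu, hfu⟩ ⟨-, c, hc⟩
  exact hfu (by simp [hc, huu])

theorem setOf_mem_activePairs_eq_empty {u : V}
    (hu : u ∉ isotropicVectors η ⊤ \ eigenVectors η f) : {v | (u, v) ∈ activePairs η f} = ∅ := by
  refine Set.eq_empty_of_forall_notMem fun v ⟨huu, _, huv, hfuv⟩ => hu ⟨⟨trivial, huu⟩, ?_⟩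
  rintro ⟨-, c, hc : f u = c • u⟩
  refine hfuv ?_
  rw [hc, map_smulₛₗ, LinearMap.smul_apply, huv, smul_zero]

theorem setOf_mem_activePairs_eq_sdiff {u : V} (huu : η u u = 0) :
    {v | (u, v) ∈ activePairs η f} = isotropicVectors η ((F ∙ u).orthogonalBilin η) \
      isotropicVectors η ((Submodule.span F {u, f u}).orthogonalBilin η) := by
  ext v
  simp only [activePairs, isotropicVectors, Set.mem_ofPred_eq, Set.mem_sdiff,
    mem_orthogonalBilin_span_singleton, mem_orthogonalBilin_span_pair]
  tauto

theorem apply_map_self_eq_zero [RingHomInvPair σ σ] (hη : η.IsSymm) (hf : (η.comp f).IsAlt)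
    (u : V) : η u (f u) = 0 :=
  hη.isRefl _ _ (hf u)

theorem exists_comp_eq [RingHomInvPair σ σ] [FiniteDimensional F V] (hnd : η.SeparatingLeft)
    (B : V →ₗ[F] V →ₗ[F] F) : ∃ f : V →ₛₗ[σ] V, η.comp f = B := by
  have hinj : Function.Injective η :=
    LinearMap.ker_eq_bot.1 (LinearMap.separatingLeft_iff_ker_eq_bot.1 hnd)
  have hsurj : Function.Surjective η := by
    rw [← LinearMap.range_eq_top, LinearMap.range_eq_map]
    exact Submodule.eq_top_of_finrank_eq
      (by rw [finrank_map_of_injective hinj, finrank_top, Subspace.dual_finrank_eq])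
  let e := LinearEquiv.ofBijective η ⟨hinj, hsurj⟩
  exact ⟨e.symm.toLinearMap.comp B, LinearMap.ext fun u => e.apply_symm_apply (B u)⟩

variable {q : ℕ} [IsFrobeniusInvolution q σ]

theorem linearIndependent_of_notMem_eigenVectors {u : V}
    (hu : u ∈ isotropicVectors η ⊤ \ eigenVectors η f) : LinearIndependent F ![u, f u] := by
  have hu0 : u ≠ 0 := fun h0 => hu.2 (h0 ▸ zero_mem_eigenVectors)
  refine linearIndependent_pair_of_notMem hu0 fun h => hu.2 ⟨hu.1.2, ?_⟩
  obtain ⟨c, hc⟩ := Submodule.mem_span_singleton.1 h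
  exact ⟨c, hc.symm⟩

variable [Finite V]

theorem ncard_setOf_mem_activePairs (hη : η.IsSymm) (hnd : η.SeparatingLeft) {n ρ : ℕ}
    (hV : finrank F V = n + 4) {u : V} (hu : u ∈ isotropicVectors η ⊤ \ eigenVectors η f)
    (hρ : finrank F (radical η (Submodule.span F {u, f u})) = ρ) :
    ({v | (u, v) ∈ activePairs η f}.ncard : ℤ) =
      (q ^ (2 * n + 5) + (-1) ^ n * (q - 1) * q ^ (n + 3)) -
        (q ^ (2 * n + 3) + (-1) ^ (n + ρ) * (q - 1) * q ^ (n + 1 + ρ)) := by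
  have hu0 : u ≠ 0 := fun h0 => hu.2 (h0 ▸ zero_mem_eigenVectors)
  have hle : (Submodule.span F {u, f u}).orthogonalBilin η ≤ (F ∙ u).orthogonalBilin η :=
    Submodule.orthogonalBilin_le (Submodule.span_mono (by simp))
  have hpair := finrank_span_pair (linearIndependent_of_notMem_eigenVectors hu)
  have hdiff := Set.ncard_sdiff_add_ncard_of_subset (isotropicVectors_mono (η := η) hle)
  rw [← setOf_mem_activePairs_eq_sdiff hu.1.2] at hdiff
  have h₁ := ncard_isotropicVectors_orthogonalBilin_singleton hη hnd (d := n + 2) hV hu0 hu.1.2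
  have h₂ := ncard_isotropicVectors_orthogonalBilin hη hnd (d := n + 1) (hV.trans (by omega)) hρ
  zify at hdiff
  linear_combination hdiff + h₁ - h₂

theorem ncard_setOf_mem_activePairs_eq_indicator (hη : η.IsSymm) (hnd : η.SeparatingLeft)
    (hf : (η.comp f).IsAlt) {n : ℕ} (hV : finrank F V = n + 4) (u : V) :
    ({v | (u, v) ∈ activePairs η f}.ncard : ℤ) =
      (isotropicVectors η ⊤ \ eigenVectors η f).indicator
        (fun _ => ((q : ℤ) ^ 2 - 1) * q ^ (2 * n + 3)) u +
      (escapingVectors η f).indicator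
        (fun _ => ((q : ℤ) ^ 2 - 1) * ((-1) ^ n * q ^ (n + 2))) u := by
  classical
  by_cases hu : u ∈ isotropicVectors η ⊤ \ eigenVectors η f
  · have hu0 : u ≠ 0 := fun h0 => hu.2 (h0 ▸ zero_mem_eigenVectors)
    have hufu := apply_map_self_eq_zero hη hf u
    rw [Set.indicator_of_mem hu]
    by_cases hfu : η (f u) (f u) = 0
    · rw [Set.indicator_of_notMem fun h => h.2 hfu,
        ncard_setOf_mem_activePairs hη hnd hV hu (finrank_radical_span_pair_of_isotropic hη.isRefl
          (linearIndependent_of_notMem_eigenVectors hu) hu.1.2 hfu hufu)]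
      ring
    · rw [Set.indicator_of_mem (show u ∈ escapingVectors η f from ⟨hu.1.2, hfu⟩),
        ncard_setOf_mem_activePairs hη hnd hV hu
          (finrank_radical_span_pair_of_anisotropic hη.isRefl hu0 hu.1.2 hfu hufu)]
      ring
  · have hesc : u ∉ escapingVectors η f := fun h =>
      hu ⟨escapingVectors_subset h, Set.disjoint_left.1 disjoint_escapingVectors_eigenVectors h⟩
    rw [Set.indicator_of_notMem hu, Set.indicator_of_notMem hesc,
      setOf_mem_activePairs_eq_empty hu]
    simp

/-- The weight of the codeword of the alternating form `η (f u) v`, multiplied by `q ^ 4 - 1`, for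
`dim V = n + 4`. -/
noncomputable def scaledWeight (η : V →ₛₗ[σ] V →ₗ[F] F) (f : V →ₛₗ[σ] V) (q n : ℕ) : ℤ :=
  q ^ (2 * n + 1) * ((isotropicVectors η ⊤).ncard - (eigenVectors η f).ncard) +
    (-1) ^ n * q ^ n * (escapingVectors η f).ncard

theorem ncard_activePairs (hη : η.IsSymm) (hnd : η.SeparatingLeft)
    (hf : (η.comp f).IsAlt) {n : ℕ} (hV : finrank F V = n + 4) :
    ((activePairs η f).ncard : ℤ) = (q ^ 2 - 1) * q ^ 2 * scaledWeight η f q n := by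
  have hcount := ncard_setOf_prod_eq_of_indicator
    (ncard_setOf_mem_activePairs_eq_indicator hη hnd hf hV)
  have hdiff := Set.ncard_sdiff_add_ncard_of_subset (eigenVectors_subset (η := η) (f := f))
  zify at hdiff
  rw [Set.ofPred_mem_eq] at hcount
  rw [hcount, scaledWeight, ← hdiff]
  ring

end SemilinearMap

section FixedVectors

variable {F V : Type*} [Field F] [AddCommGroup V] [Module F V] {σ : F →+* F}
  {η : V →ₛₗ[σ] V →ₗ[F] F} {f : V →ₛₗ[σ] V}

/-- The vectors that the semilinear map `f` multiplies by `c`. For `c ≠ 0` they form a vector space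
over the subfield fixed by `σ` only. -/
def fixedVectors (f : V →ₛₗ[σ] V) (c : F) : Set V :=
  {u | f u = c • u}

theorem fixedVectors_subset_range [RingHomInvPair σ σ] {c : F} (hc : c ≠ 0) :
    fixedVectors f c ⊆ LinearMap.range f := by
  intro u (hu : f u = c • u)
  refine ⟨σ c⁻¹ • u, ?_⟩
  rw [map_smulₛₗ, ← RingHom.comp_apply, RingHomCompTriple.comp_eq, RingHom.id_apply, hu,
    inv_smul_smul₀ hc]

theorem fixedVectors_subset_eigenspace [RingHomInvPair σ σ] (c : F) :
    fixedVectors f c ⊆ Module.End.eigenspace (f.comp f) (σ c * c) := by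
  intro u (hu : f u = c • u)
  rw [SetLike.mem_coe, Module.End.mem_eigenspace_iff, LinearMap.comp_apply, hu, map_smulₛₗ, hu,
    smul_smul]

theorem injOn_add_smul_fixedVectors {c : F} (hc : c ≠ 0) {a : F} (ha : σ a ≠ a) :
    Set.InjOn (fun p : V × V => p.1 + a • p.2) (fixedVectors f c ×ˢ fixedVectors f c) := by
  rintro ⟨u, v⟩ ⟨hu : f u = c • u, hv : f v = c • v⟩ ⟨u', v'⟩
    ⟨hu' : f u' = c • u', hv' : f v' = c • v'⟩ (heq : u + a • v = u' + a • v')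
  have hconj : u + σ a • v = u' + σ a • v' := by
    have := congrArg f heq
    rw [map_add, map_add, map_smulₛₗ, map_smulₛₗ, hu, hv, hu', hv', smul_comm (σ a) c,
      smul_comm (σ a) c, ← smul_add, ← smul_add] at this
    exact smul_right_injective V hc this
  have hsub : (a - σ a) • (v - v') = 0 := by linear_combination (norm := module) heq - hconj
  obtain rfl : v = v' :=
    sub_eq_zero.1 ((smul_eq_zero.1 hsub).resolve_left (sub_ne_zero.2 (Ne.symm ha)))
  rw [add_right_cancel heq]

theorem eigenVectors_subset_union {C : Set F}
    (hC : ∀ u ≠ 0, ∀ c ≠ 0, f u = c • u → c ∈ C) :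
    eigenVectors η f ⊆
      isotropicVectors η (LinearMap.ker f) ∪ ⋃ c ∈ C, fixedVectors f c \ {0} := by
  rintro u ⟨huu, c, hc⟩
  by_cases hfu : f u = 0
  · exact Or.inl ⟨hfu, huu⟩
  · have hu : u ≠ 0 := fun hu => hfu (by rw [hu, map_zero])
    have hc0 : c ≠ 0 := fun hc0 => hfu (by rw [hc, hc0, zero_smul])
    exact Or.inr (Set.mem_biUnion (hC u hu c hc0 hc) ⟨hc, hu⟩)

theorem ncard_eigenVectors_le [Finite F] [Finite V] {C : Set F} {K : ℕ}
    (hC : ∀ u ≠ 0, ∀ c ≠ 0, f u = c • u → c ∈ C)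
    (hK : ∀ c ∈ C, (fixedVectors f c).ncard ≤ K) :
    ((eigenVectors η f).ncard : ℤ) ≤
      (isotropicVectors η (LinearMap.ker f)).ncard + C.ncard * (K - 1) := by
  have hfix : ∀ c ∈ C, ((fixedVectors f c \ {0}).ncard : ℤ) ≤ K - 1 := fun c hc => by
    have hzero : (0 : V) ∈ fixedVectors f c := by simp [fixedVectors]
    have := Set.ncard_sdiff_singleton_add_one hzero
    have := hK c hc
    omega
  have hunion : ((⋃ c ∈ C, fixedVectors f c \ {0}).ncard : ℤ) ≤ C.ncard * (K - 1) := by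
    have hle := (Set.toFinite C).toFinset.set_ncard_biUnion_le fun c => fixedVectors f c \ {0}
    simp only [Set.Finite.mem_toFinset] at hle
    zify at hle
    refine hle.trans ((Finset.sum_le_card_nsmul _ _ _ fun c hc => hfix c (by simpa using hc)).trans
      (le_of_eq ?_))
    rw [Set.ncard_eq_toFinset_card C, nsmul_eq_mul]
  have hle := (Set.ncard_le_ncard (eigenVectors_subset_union (η := η) hC)).trans
    (Set.ncard_union_le _ _)
  zify at hle
  linarith

variable {q : ℕ} [IsFrobeniusInvolution q σ] [Finite V]

theorem ncard_fixedVectors_le {c : F} (hc : c ≠ 0) {W : Submodule F V}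
    (hW : fixedVectors f c ⊆ W) : (fixedVectors f c).ncard ≤ q ^ finrank F W := by
  obtain ⟨a, ha⟩ := IsFrobeniusInvolution.exists_apply_ne σ
  have hsub : (fun p : V × V => p.1 + a • p.2) '' (fixedVectors f c ×ˢ fixedVectors f c) ⊆ W := by
    rintro _ ⟨⟨u, v⟩, ⟨hu, hv⟩, rfl⟩
    exact W.add_mem (hW hu) (W.smul_mem _ (hW hv))
  have hcard := Set.ncard_le_ncard hsub
  rw [(injOn_add_smul_fixedVectors hc ha).ncard_image, Set.ncard_prod,
    IsFrobeniusInvolution.ncard_submodule σ, two_mul, pow_add] at hcard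
  exact Nat.mul_self_le_mul_self_iff.1 hcard

theorem ncard_eigenVectors_le_of_forall_ncard_fixedVectors_le {k : ℕ}
    (hk : ∀ c ≠ 0, (fixedVectors f c).ncard ≤ q ^ k) :
    ((eigenVectors η f).ncard : ℤ) ≤
      (isotropicVectors η (LinearMap.ker f)).ncard + (q ^ 2 - 1) * (q ^ k - 1) := by
  have := IsFrobeniusInvolution.finite σ
  have hcard : (({0}ᶜ : Set F).ncard : ℤ) = q ^ 2 - 1 := by
    have := Set.ncard_add_ncard_compl ({0} : Set F)
    rw [Set.ncard_singleton, IsFrobeniusInvolution.natCard_eq σ] at this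
    zify at this
    linarith
  have := ncard_eigenVectors_le (η := η) (C := {0}ᶜ) (fun _ _ _ hc _ => hc) hk
  rw [hcard] at this
  exact_mod_cast this

theorem ncard_eigenVectors_le_of_range_le_eigenspace {k : ℕ} {t : F} (ht : t ≠ 0)
    (hsq : LinearMap.range f ≤ Module.End.eigenspace (f.comp f) t)
    (hk : ∀ c ≠ 0, (fixedVectors f c).ncard ≤ q ^ k) :
    ((eigenVectors η f).ncard : ℤ) ≤
      (isotropicVectors η (LinearMap.ker f)).ncard + (q + 1) * (q ^ k - 1) := by
  have := IsFrobeniusInvolution.finite σ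
  have hC : ∀ u ≠ 0, ∀ c ≠ 0, f u = c • u → c ∈ {c | σ c * c = t} := fun u hu c hc huc => by
    have h₁ := Module.End.mem_eigenspace_iff.1 (hsq (fixedVectors_subset_range hc huc))
    have h₂ := Module.End.mem_eigenspace_iff.1 (fixedVectors_subset_eigenspace c huc)
    exact smul_left_injective F hu (h₂.symm.trans h₁)
  have hle := ncard_eigenVectors_le (η := η) (K := q ^ k) hC fun c hc =>
    hk c (right_ne_zero_of_mul (hc.trans_ne ht))
  have hq : (1 : ℤ) ≤ q ^ k :=
    one_le_pow₀ (by exact_mod_cast one_le_two.trans (IsFrobeniusInvolution.two_le σ))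
  have hnorm := IsFrobeniusInvolution.ncard_setOf_mul_eq_le σ t
  zify at hnorm
  push_cast at hle
  nlinarith

end FixedVectors

section EigenvectorBounds

variable {F V : Type*} [Field F] [AddCommGroup V] [Module F V] {σ : F →+* F}
  {η : V →ₛₗ[σ] V →ₗ[F] F} {f : V →ₛₗ[σ] V}

theorem orthogonalBilin_range [RingHomInvPair σ σ] (hnd : η.SeparatingLeft)
    (hf : (η.comp f).IsAlt) : (LinearMap.range f).orthogonalBilin η = LinearMap.ker f := by
  have hswap (u v : V) : η (f u) v = 0 ↔ η (f v) u = 0 := ⟨hf.isRefl u v, hf.isRefl v u⟩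
  ext v
  simp only [Submodule.mem_orthogonalBilin_iff, LinearMap.mem_range, forall_exists_index,
    forall_apply_eq_imp_iff, LinearMap.mem_ker]
  exact ⟨fun hv => hnd _ fun u => (hswap u v).1 (hv u), fun hv u => (hswap u v).2 (by simp [hv])⟩

section Rank

variable [FiniteDimensional F V] [RingHomInvPair σ σ]

theorem finrank_range_add_finrank_ker (hnd : η.SeparatingLeft) (hf : (η.comp f).IsAlt) :
    finrank F (LinearMap.range f) + finrank F (LinearMap.ker f) = finrank F V := by
  rw [← orthogonalBilin_range hnd hf, finrank_add_finrank_orthogonalBilin hnd]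

theorem radical_range (hη : η.IsSymm) (hnd : η.SeparatingLeft) (hf : (η.comp f).IsAlt) :
    radical η (LinearMap.range f) = radical η (LinearMap.ker f) := by
  rw [← orthogonalBilin_range hnd hf, radical_orthogonalBilin hnd hη.isRefl]

theorem even_finrank_range (hnd : η.SeparatingLeft) (hf : (η.comp f).IsAlt) :
    Even (finrank F (LinearMap.range f)) := by
  have heven := even_finrank_add_finrank_radical hf ⊤
  have hrad : radical (η.comp f) ⊤ = LinearMap.ker f := by
    ext v
    rw [mem_radical, LinearMap.mem_ker]
    exact ⟨fun hv => hnd _ fun u => hf.isRefl u v (hv.2 u trivial),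
      fun hv => ⟨trivial, fun u _ => hf.isRefl v u (by simp [hv])⟩⟩
  rw [hrad, finrank_top, ← finrank_range_add_finrank_ker hnd hf, add_assoc] at heven
  exact (Nat.even_add.1 heven).2 (Even.add_self _)

end Rank

variable {q : ℕ} [IsFrobeniusInvolution q σ] [Finite V]

theorem ncard_isotropicVectors_le (W : Submodule F V) :
    (isotropicVectors η W).ncard ≤ q ^ (2 * finrank F W) := by
  rw [← IsFrobeniusInvolution.ncard_submodule σ]
  exact Set.ncard_le_ncard (isotropicVectors_subset W)

theorem ncard_eigenVectors_le_pow :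
    ((eigenVectors η f).ncard : ℤ) ≤ q ^ (2 * finrank F (LinearMap.ker f)) +
      (q ^ 2 - 1) * (q ^ finrank F (LinearMap.range f) - 1) := by
  have hle := ncard_eigenVectors_le_of_forall_ncard_fixedVectors_le (η := η) fun c hc =>
    ncard_fixedVectors_le hc (fixedVectors_subset_range (f := f) hc)
  have hker := ncard_isotropicVectors_le (η := η) (LinearMap.ker f)
  zify at hker
  linarith

/-- If some `fixedVectors f c` is larger than `q ^ k`, it spans `V`, so `f ∘ f` is a scalar and at
most `q + 1` values of `c` occur. -/
theorem ncard_eigenVectors_le_of_ker_eq_bot {k : ℕ} (hV : finrank F V = k + 1)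
    (hf : LinearMap.ker f = ⊥) :
    ((eigenVectors η f).ncard : ℤ) ≤ 1 + (q + 1) * (q ^ (k + 1) - 1) := by
  have hq : (2 : ℤ) ≤ q := by exact_mod_cast IsFrobeniusInvolution.two_le σ
  have hiso : ((isotropicVectors η (LinearMap.ker f)).ncard : ℤ) = 1 := by
    rw [hf, isotropicVectors_bot, Set.ncard_singleton, Nat.cast_one]
  by_cases! hlarge : ∃ c ≠ 0, q ^ k < (fixedVectors f c).ncard
  · obtain ⟨c, hc, hck⟩ := hlarge
    have hpow := hck.trans_le (ncard_fixedVectors_le hc (fixedVectors_subset_eigenspace c))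
    have hlt := (Nat.pow_lt_pow_iff_right (IsFrobeniusInvolution.two_le σ)).1 hpow
    have htop : Module.End.eigenspace (f.comp f) (σ c * c) = ⊤ :=
      Submodule.eq_top_of_finrank_eq (le_antisymm (Submodule.finrank_le _) (by omega))
    have hle := ncard_eigenVectors_le_of_range_le_eigenspace (η := η) (f := f) (k := k + 1)
      (mul_ne_zero ((map_ne_zero σ).2 hc) hc) (htop ▸ le_top) fun c hc => by
        have := ncard_fixedVectors_le (f := f) hc (W := ⊤) (Set.subset_univ _)
        rwa [finrank_top, hV] at this
    rwa [hiso] at hle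
  · have hle := ncard_eigenVectors_le_of_forall_ncard_fixedVectors_le (η := η) hlarge
    have hone : (1 : ℤ) ≤ q ^ k := one_le_pow₀ (by linarith)
    calc ((eigenVectors η f).ncard : ℤ) ≤ 1 + (q ^ 2 - 1) * (q ^ k - 1) := hiso ▸ hle
      _ = 1 + (q + 1) * (q ^ (k + 1) - 1) - (q + 1) * (q ^ k + q - 2) := by ring
      _ ≤ 1 + (q + 1) * (q ^ (k + 1) - 1) :=
        sub_le_self _ (mul_nonneg (by linarith) (by linarith))

end EigenvectorBounds

section WeightBounds

variable {F V : Type*} [Field F] [AddCommGroup V] [Module F V] {σ : F →+* F}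
  {η : V →ₛₗ[σ] V →ₗ[F] F} {f : V →ₛₗ[σ] V} {q n : ℕ}

/-- The minimum distance of the line Hermitian Grassmann code of a space of dimension `n + 4`, as
far as forms `η (f u) v` with few vectors in `eigenVectors η f` are concerned. -/
def genericMinDist (q n : ℕ) : ℤ :=
  if Even n then q ^ (4 * n + 4) else q ^ (4 * n + 4) - q ^ (3 * n + 3)

theorem genericMinDist_of_even (hn : Even n) : genericMinDist q n = q ^ (4 * n + 4) :=
  if_pos hn

theorem genericMinDist_of_odd (hn : Odd n) :
    genericMinDist q n = q ^ (4 * n + 4) - q ^ (3 * n + 3) :=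
  if_neg (Nat.not_even_iff_odd.2 hn)

theorem ncard_escapingVectors_add_ncard_le [Finite V] {S : Set V}
    (hS : ∀ u ∈ S, η u u = 0 ∧ η (f u) (f u) = 0) :
    (escapingVectors η f).ncard + S.ncard ≤ (isotropicVectors η ⊤).ncard := by
  rw [← Set.ncard_union_eq (Set.disjoint_left.2 fun u hu hu' => hu.2 (hS u hu').2)]
  exact Set.ncard_le_ncard
    (Set.union_subset escapingVectors_subset fun u hu => ⟨trivial, (hS u hu).1⟩)

theorem ncard_escapingVectors_add_ncard_eigenVectors_le [Finite V] :
    (escapingVectors η f).ncard + (eigenVectors η f).ncard ≤ (isotropicVectors η ⊤).ncard :=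
  ncard_escapingVectors_add_ncard_le fun u ⟨huu, c, hc⟩ => ⟨huu, by simp [hc, huu]⟩

variable [IsFrobeniusInvolution q σ] [Finite V] {E D : ℤ}

theorem le_scaledWeight_of_even (hη : η.IsSymm) (hnd : η.SeparatingLeft)
    (hV : finrank F V = n + 4) (hn : Even n) (hE : (eigenVectors η f).ncard ≤ E) :
    q ^ (2 * n + 1) * (q ^ (2 * n + 7) + (q - 1) * q ^ (n + 3) - E) ≤ scaledWeight η f q n := by
  rw [scaledWeight, ncard_isotropicVectors_top hη hnd (d := n + 3) hV, hn.neg_one_pow,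
    hn.add_odd (by decide : Odd 3) |>.neg_one_pow]
  have hesc : (0 : ℤ) ≤ q ^ n * (escapingVectors η f).ncard := by positivity
  have heig := mul_le_mul_of_nonneg_left hE (by positivity : (0 : ℤ) ≤ q ^ (2 * n + 1))
  linear_combination hesc + heig

theorem le_scaledWeight_of_odd (hη : η.IsSymm) (hnd : η.SeparatingLeft)
    (hV : finrank F V = n + 4) (hn : Odd n) (hE : (eigenVectors η f).ncard ≤ E)
    (hD : (escapingVectors η f).ncard ≤ D) :
    q ^ (2 * n + 1) * (q ^ (2 * n + 7) - (q - 1) * q ^ (n + 3) - E) - q ^ n * D ≤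
      scaledWeight η f q n := by
  rw [scaledWeight, ncard_isotropicVectors_top hη hnd (d := n + 3) hV, hn.neg_one_pow,
    hn.add_odd (by decide : Odd 3) |>.neg_one_pow]
  have hesc := mul_le_mul_of_nonneg_left hD (by positivity : (0 : ℤ) ≤ q ^ n)
  have heig := mul_le_mul_of_nonneg_left hE (by positivity : (0 : ℤ) ≤ q ^ (2 * n + 1))
  linear_combination hesc + heig

theorem genericMinDist_mul_le_scaledWeight (hη : η.IsSymm) (hnd : η.SeparatingLeft)
    (hV : finrank F V = n + 4) (hE : ((eigenVectors η f).ncard : ℤ) ≤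
      q ^ (2 * n + 3) + (-1) ^ n * (q - 1) * q ^ (n + 3)) :
    genericMinDist q n * (q ^ 4 - 1) ≤ scaledWeight η f q n := by
  rcases n.even_or_odd with hn | hn
  · refine le_trans (le_of_eq ?_) (le_scaledWeight_of_even hη hnd hV hn hE)
    rw [genericMinDist_of_even hn, hn.neg_one_pow]
    ring
  · have hI := ncard_isotropicVectors_top hη hnd (d := n + 3) hV
    have hq : (1 : ℤ) ≤ q := by exact_mod_cast one_le_two.trans (IsFrobeniusInvolution.two_le σ)
    have hpow : (0 : ℤ) ≤ q ^ (2 * n + 1) - q ^ n := sub_nonneg.2 (pow_le_pow_right₀ hq (by omega))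
    have hesc := ncard_escapingVectors_add_ncard_eigenVectors_le (η := η) (f := f)
    zify at hesc
    have hesc' := mul_le_mul_of_nonneg_left hesc (by positivity : (0 : ℤ) ≤ q ^ n)
    rw [hn.add_odd (by decide : Odd 3) |>.neg_one_pow] at hI
    rw [hn.neg_one_pow] at hE
    rw [genericMinDist_of_odd hn, scaledWeight, hn.neg_one_pow]
    calc ((q : ℤ) ^ (4 * n + 4) - q ^ (3 * n + 3)) * (q ^ 4 - 1)
        = ((q : ℤ) ^ (2 * n + 1) - q ^ n) * (q ^ (2 * n + 3) * (q ^ 4 - 1)) := by ring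
      _ ≤ ((q : ℤ) ^ (2 * n + 1) - q ^ n) *
          ((isotropicVectors η ⊤).ncard - (eigenVectors η f).ncard) :=
        mul_le_mul_of_nonneg_left (by linear_combination hE - hI) hpow
      _ ≤ _ := by linear_combination hesc'

theorem genericMinDist_mul_le_scaledWeight_of_four_le_rank (hη : η.IsSymm)
    (hnd : η.SeparatingLeft) (hf : (η.comp f).IsAlt) (hV : finrank F V = n + 4) (hn : 3 ≤ n)
    (hr : 4 ≤ finrank F (LinearMap.range f)) :
    genericMinDist q n * (q ^ 4 - 1) ≤ scaledWeight η f q n := by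
  refine genericMinDist_mul_le_scaledWeight hη hnd hV (ncard_eigenVectors_le_pow.trans ?_)
  have hq : (2 : ℤ) ≤ q := by exact_mod_cast IsFrobeniusInvolution.two_le σ
  have hdim := finrank_range_add_finrank_ker hnd hf
  have hker : (q : ℤ) ^ (2 * finrank F (LinearMap.ker f)) ≤ q ^ (2 * n) :=
    pow_le_pow_right₀ (by linarith) (by omega)
  have hrange : (q : ℤ) ^ finrank F (LinearMap.range f) ≤ q ^ (n + 4) :=
    pow_le_pow_right₀ (by linarith) (by omega)
  have hn3 : (q : ℤ) ^ 3 ≤ q ^ n := pow_le_pow_right₀ (by linarith) hn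
  have hsign : -((q - 1) * (q : ℤ) ^ (n + 3)) ≤ (-1) ^ n * (q - 1) * q ^ (n + 3) := by
    have : (0 : ℤ) ≤ (q - 1) * q ^ (n + 3) := mul_nonneg (by linarith) (by positivity)
    rcases neg_one_pow_eq_or ℤ n with h | h <;> rw [h] <;> linarith
  have hprod : (0 : ℤ) ≤ q ^ n * ((q ^ n - q ^ 3) * (q ^ 3 - 1)) :=
    mul_nonneg (by positivity)
      (mul_nonneg (by linarith) (sub_nonneg.2 (one_le_pow₀ (by linarith))))
  have hq2 : (1 : ℤ) ≤ q ^ 2 := one_le_pow₀ (by linarith)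
  calc (q : ℤ) ^ (2 * finrank F (LinearMap.ker f)) +
        (q ^ 2 - 1) * (q ^ finrank F (LinearMap.range f) - 1)
      ≤ (q : ℤ) ^ (2 * n) + (q ^ 2 - 1) * q ^ (n + 4) := by
        gcongr
        linarith
    _ = (q : ℤ) ^ (2 * n + 3) - (q - 1) * q ^ (n + 3) -
        q ^ n * ((q ^ n - q ^ 3) * (q ^ 3 - 1)) := by ring
    _ ≤ (q : ℤ) ^ (2 * n + 3) + (-1) ^ n * (q - 1) * q ^ (n + 3) := by linarith

end WeightBounds

section RankTwo

variable {F V : Type*} [Field F] [AddCommGroup V] [Module F V] {σ : F →+* F}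
  {η : V →ₛₗ[σ] V →ₗ[F] F} {f : V →ₛₗ[σ] V}

theorem ncard_eigenVectors_add_ncard_radical_le [RingHomInvPair σ σ] [Finite V]
    (hnd : η.SeparatingLeft) (hf : (η.comp f).IsAlt) :
    (eigenVectors η f).ncard + (radical η (LinearMap.range f) : Set V).ncard ≤
      (isotropicVectors η (LinearMap.ker f)).ncard +
        (isotropicVectors η (LinearMap.range f)).ncard := by
  have hrad : (radical η (LinearMap.range f) : Set V) ⊆ isotropicVectors η (LinearMap.range f) :=
    fun x hx => ⟨hx.1, hx.2 x hx.1⟩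
  rw [← Set.ncard_sdiff_add_ncard_of_subset hrad, ← add_assoc]
  refine Nat.add_le_add_right ((Set.ncard_le_ncard ?_).trans (Set.ncard_union_le _ _)) _
  rintro u ⟨huu, c, hc⟩
  by_cases hfu : f u = 0
  · exact Or.inl ⟨hfu, huu⟩
  · have hc0 : c ≠ 0 := fun hc0 => hfu (by rw [hc, hc0, zero_smul])
    refine Or.inr ⟨⟨fixedVectors_subset_range hc0 hc, huu⟩, fun hu => hfu ?_⟩
    have hperp := hu.2
    rwa [orthogonalBilin_range hnd hf] at hperp

/-- If `f u` is not a multiple of `p`, then `range f = ⟨p, f u⟩` is orthogonal to `u`, so that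
`f u = 0`. -/
theorem apply_map_map_eq_zero_of_finrank_range_eq_two [RingHomInvPair σ σ]
    [FiniteDimensional F V] (hnd : η.SeparatingLeft) (hf : (η.comp f).IsAlt)
    (hr : finrank F (LinearMap.range f) = 2) {p : V} (hp : p ≠ 0)
    (hpf : p ∈ LinearMap.range f) (hpp : η p p = 0) {u : V} (hpu : η p u = 0) :
    η (f u) (f u) = 0 := by
  by_cases hfu : f u ∈ F ∙ p
  · obtain ⟨c, hc⟩ := Submodule.mem_span_singleton.1 hfu
    simp [← hc, hpp]
  · have hspan : Submodule.span F {p, f u} = LinearMap.range f := by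
      refine Submodule.eq_of_le_of_finrank_eq ?_
        (by rw [finrank_span_pair (linearIndependent_pair_of_notMem hp hfu), hr])
      exact Submodule.span_le.2 (Set.pair_subset hpf ⟨u, rfl⟩)
    have hu : u ∈ (LinearMap.range f).orthogonalBilin η :=
      hspan ▸ mem_orthogonalBilin_span_pair.2 ⟨hpu, hf u⟩
    rw [orthogonalBilin_range hnd hf, LinearMap.mem_ker] at hu
    simp [hu]

theorem injOn_add_of_radical_range_eq_bot [RingHomInvPair σ σ] (hnd : η.SeparatingLeft)
    (hf : (η.comp f).IsAlt) (hrad : radical η (LinearMap.range f) = ⊥) :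
    Set.InjOn (fun p : V × V => p.1 + p.2)
      ((LinearMap.ker f : Set V) ×ˢ (LinearMap.range f : Set V)) := by
  rintro ⟨r, l⟩ ⟨hr, hl⟩ ⟨r', l'⟩ ⟨hr', hl'⟩ (heq : r + l = r' + l')
  have hsub : l - l' = r' - r := by
    rw [sub_eq_sub_iff_add_eq_add, add_comm l, add_comm r', heq, add_comm]
  have hmem : l - l' ∈ radical η (LinearMap.range f) := by
    refine ⟨Submodule.sub_mem _ hl hl', ?_⟩
    rw [orthogonalBilin_range hnd hf, hsub]
    exact Submodule.sub_mem _ hr' hr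
  rw [hrad, Submodule.mem_bot, sub_eq_zero] at hmem
  subst hmem
  rw [add_right_cancel heq]

theorem ncard_escapingVectors_add_mul_le [RingHomInvPair σ σ] [Finite V] (hη : η.IsSymm)
    (hnd : η.SeparatingLeft) (hf : (η.comp f).IsAlt)
    (hr : finrank F (LinearMap.range f) = 2) (hrad : radical η (LinearMap.range f) = ⊥) :
    (escapingVectors η f).ncard + (isotropicVectors η (LinearMap.ker f)).ncard *
      (isotropicVectors η (LinearMap.range f)).ncard ≤ (isotropicVectors η ⊤).ncard := by
  have hinj := (injOn_add_of_radical_range_eq_bot hnd hf hrad).mono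
    (Set.prod_mono (isotropicVectors_subset (η := η) _) (isotropicVectors_subset (η := η) _))
  rw [← Set.ncard_prod, ← hinj.ncard_image]
  refine ncard_escapingVectors_add_ncard_le ?_
  rintro _ ⟨⟨r, l⟩, ⟨⟨hr₀, hrr⟩, hl, hll⟩, rfl⟩
  rw [← orthogonalBilin_range hnd hf] at hr₀
  have hlr : η l r = 0 := hr₀ l hl
  have hrl : η r l = 0 := hη.isRefl _ _ hlr
  refine ⟨by simp [hrr, hll, hlr, hrl], ?_⟩
  obtain rfl | hl₀ := eq_or_ne l 0
  · rw [orthogonalBilin_range hnd hf, LinearMap.mem_ker] at hr₀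
    simp [hr₀]
  · exact apply_map_map_eq_zero_of_finrank_range_eq_two hnd hf hr hl₀ hl hll
      (by simp [hlr, hll])

variable {q n : ℕ} [IsFrobeniusInvolution q σ] [Finite V]

theorem ncard_isotropicVectors_ker (hη : η.IsSymm) (hnd : η.SeparatingLeft)
    (hf : (η.comp f).IsAlt) (hV : finrank F V = n + 4) (hr : finrank F (LinearMap.range f) = 2)
    {ρ : ℕ} (hρ : finrank F (radical η (LinearMap.range f)) = ρ) :
    ((isotropicVectors η (LinearMap.ker f)).ncard : ℤ) =
      q ^ (2 * n + 3) + (-1) ^ (n + ρ) * (q - 1) * q ^ (n + 1 + ρ) := by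
  have hdim := finrank_range_add_finrank_ker hnd hf
  rw [radical_range hη hnd hf] at hρ
  rw [ncard_isotropicVectors hη (d := n + 1) (by omega) hρ]
  ring

theorem ncard_eigenVectors_le_of_finrank_range_eq_two (hη : η.IsSymm) (hnd : η.SeparatingLeft)
    (hf : (η.comp f).IsAlt) (hV : finrank F V = n + 4) (hr : finrank F (LinearMap.range f) = 2)
    {ρ : ℕ} (hρ : finrank F (radical η (LinearMap.range f)) = ρ) :
    ((eigenVectors η f).ncard : ℤ) ≤
      q ^ (2 * n + 3) + (-1) ^ (n + ρ) * (q - 1) * q ^ (n + 1 + ρ) +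
        (q ^ 3 + (-1) ^ ρ * (q - 1) * q ^ (1 + ρ)) - q ^ (2 * ρ) := by
  have hle := ncard_eigenVectors_add_ncard_radical_le hnd hf
  rw [IsFrobeniusInvolution.ncard_submodule σ, hρ] at hle
  zify at hle
  rw [ncard_isotropicVectors_ker hη hnd hf hV hr hρ, ncard_isotropicVectors hη (d := 1) hr hρ]
    at hle
  linear_combination hle

theorem genericMinDist_mul_le_of_radical_eq_bot (hη : η.IsSymm) (hnd : η.SeparatingLeft)
    (hf : (η.comp f).IsAlt) (hV : finrank F V = n + 4) (hn : 1 ≤ n)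
    (hr : finrank F (LinearMap.range f) = 2) (hrad : radical η (LinearMap.range f) = ⊥) :
    genericMinDist q n * (q ^ 4 - 1) ≤ scaledWeight η f q n := by
  have hρ : finrank F (radical η (LinearMap.range f)) = 0 := by rw [hrad, finrank_bot]
  have hq : (2 : ℤ) ≤ q := by exact_mod_cast IsFrobeniusInvolution.two_le σ
  have hE := ncard_eigenVectors_le_of_finrank_range_eq_two hη hnd hf hV hr hρ
  rcases n.even_or_odd with hn' | hn'
  · refine genericMinDist_mul_le_scaledWeight hη hnd hV (hE.trans (sub_nonneg.1 ?_))
    rw [add_zero, hn'.neg_one_pow]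
    have hpow : (q : ℤ) ^ 2 ≤ q ^ n :=
      pow_le_pow_right₀ (by linarith) (by obtain ⟨k, rfl⟩ := hn'; omega)
    have hgap : (0 : ℤ) ≤ (q - 1) * (q * q ^ n) - (q + 1) := by
      nlinarith [mul_le_mul_of_nonneg_left hpow (by nlinarith : (0 : ℤ) ≤ (q - 1) * q),
        mul_nonneg (by linarith : (0 : ℤ) ≤ q - 2) (by positivity : (0 : ℤ) ≤ (q : ℤ) ^ 3),
        mul_nonneg (by linarith : (0 : ℤ) ≤ q - 2) (by positivity : (0 : ℤ) ≤ (q : ℤ) ^ 2)]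
    refine (mul_nonneg (by nlinarith : (0 : ℤ) ≤ q ^ 2 - 1) hgap).trans_eq ?_
    ring
  · have hD := ncard_escapingVectors_add_mul_le hη hnd hf hr hrad
    zify at hD
    rw [ncard_isotropicVectors_ker hη hnd hf hV hr hρ, ncard_isotropicVectors hη (d := 1) hr hρ,
      ncard_isotropicVectors_top hη hnd (d := n + 3) hV] at hD
    refine le_trans (sub_nonneg.1 ?_)
      (le_scaledWeight_of_odd hη hnd hV hn' hE (le_sub_iff_add_le.2 hD))
    rw [genericMinDist_of_odd hn', add_zero, hn'.neg_one_pow,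
      hn'.add_odd (by decide : Odd 3) |>.neg_one_pow]
    have hpow : (1 : ℤ) ≤ q ^ n := one_le_pow₀ (by linarith)
    have h₁ : (0 : ℤ) ≤ q * q ^ n - 1 := by nlinarith
    have h₂ : (0 : ℤ) ≤ q ^ 4 - 1 := sub_nonneg.2 (one_le_pow₀ (by linarith))
    have h₃ : (0 : ℤ) ≤ q ^ n * q ^ n * q * (q ^ 4 - 1) * (q * q ^ n - 1) := by positivity
    refine h₃.trans_eq ?_
    ring

theorem genericMinDist_mul_le_of_finrank_radical_eq_one (hη : η.IsSymm)
    (hnd : η.SeparatingLeft) (hf : (η.comp f).IsAlt) (hV : finrank F V = n + 4)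
    (hr : finrank F (LinearMap.range f) = 2)
    (hρ : finrank F (radical η (LinearMap.range f)) = 1) :
    genericMinDist q n * (q ^ 4 - 1) ≤ scaledWeight η f q n := by
  have hq : (2 : ℤ) ≤ q := by exact_mod_cast IsFrobeniusInvolution.two_le σ
  have hE := ncard_eigenVectors_le_of_finrank_range_eq_two hη hnd hf hV hr hρ
  rcases n.even_or_odd with hn | hn
  · refine genericMinDist_mul_le_scaledWeight hη hnd hV (hE.trans (sub_nonneg.1 ?_))
    rw [hn.add_one.neg_one_pow, hn.neg_one_pow]
    have : (0 : ℤ) ≤ (q - 1) * (q + 1) * q ^ (n + 2) :=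
      mul_nonneg (mul_nonneg (by linarith) (by linarith)) (by positivity)
    refine this.trans_eq ?_
    ring
  · obtain ⟨⟨p, hp⟩, hp₀⟩ := finrank_pos_iff_exists_ne_zero.1 (hρ.symm ▸ one_pos)
    have hp₀ : p ≠ 0 := fun h => hp₀ (Subtype.ext h)
    have hpp : η p p = 0 := hp.2 p hp.1
    have hD := ncard_escapingVectors_add_ncard_le (η := η) (f := f)
      (S := isotropicVectors η ((F ∙ p).orthogonalBilin η)) fun u hu => ⟨hu.2,
        apply_map_map_eq_zero_of_finrank_range_eq_two hnd hf hr hp₀ hp.1 hpp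
          (mem_orthogonalBilin_span_singleton.1 hu.1)⟩
    zify at hD
    rw [ncard_isotropicVectors_orthogonalBilin_singleton hη hnd (d := n + 2) hV hp₀ hpp,
      ncard_isotropicVectors_top hη hnd (d := n + 3) hV] at hD
    refine le_of_eq_of_le ?_ (le_scaledWeight_of_odd hη hnd hV hn hE (le_sub_iff_add_le.2 hD))
    rw [genericMinDist_of_odd hn, hn.add_one.neg_one_pow,
      hn.add_odd (by decide : Odd 3) |>.neg_one_pow, hn.add_even even_two |>.neg_one_pow]
    ring

theorem genericMinDist_mul_le_of_finrank_range_eq_two (hη : η.IsSymm) (hnd : η.SeparatingLeft)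
    (hf : (η.comp f).IsAlt) (hV : finrank F V = n + 4) (hn : 1 ≤ n)
    (hr : finrank F (LinearMap.range f) = 2) :
    genericMinDist q n * (q ^ 4 - 1) ≤ scaledWeight η f q n := by
  have hle : finrank F (radical η (LinearMap.range f)) ≤ 2 :=
    hr ▸ Submodule.finrank_mono inf_le_left
  obtain hρ | hρ | hρ : finrank F (radical η (LinearMap.range f)) = 0 ∨
      finrank F (radical η (LinearMap.range f)) = 1 ∨
      finrank F (radical η (LinearMap.range f)) = 2 := by omega
  · exact genericMinDist_mul_le_of_radical_eq_bot hη hnd hf hV hn hr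
      (Submodule.finrank_eq_zero.1 hρ)
  · exact genericMinDist_mul_le_of_finrank_radical_eq_one hη hnd hf hV hr hρ
  · refine genericMinDist_mul_le_scaledWeight hη hnd hV ?_
    refine (ncard_eigenVectors_le_of_finrank_range_eq_two hη hnd hf hV hr hρ).trans_eq ?_
    ring

end RankTwo

/-- The minimum distance of the line Hermitian Grassmann code of a space of dimension `n + 4`. -/
def minDist (q n : ℕ) : ℤ :=
  if n = 0 ∨ n = 2 then q ^ (4 * n + 4) - q ^ (2 * n + 2) else genericMinDist q n

theorem minDist_of_eq_zero_or_eq_two {q n : ℕ} (hn : n = 0 ∨ n = 2) :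
    minDist q n = q ^ (4 * n + 4) - q ^ (2 * n + 2) :=
  if_pos hn

theorem minDist_of_not {q n : ℕ} (hn : ¬(n = 0 ∨ n = 2)) : minDist q n = genericMinDist q n :=
  if_neg hn

theorem minDist_le_genericMinDist (q n : ℕ) : minDist q n ≤ genericMinDist q n := by
  by_cases hn : n = 0 ∨ n = 2
  · have heven : Even n := by obtain rfl | rfl := hn <;> decide
    rw [minDist_of_eq_zero_or_eq_two hn, genericMinDist_of_even heven]
    exact sub_le_self _ (by positivity)
  · exact (minDist_of_not hn).le

section SmallDimension

variable {F V : Type*} [Field F] [AddCommGroup V] [Module F V] {σ : F →+* F}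
  {η : V →ₛₗ[σ] V →ₗ[F] F} {f : V →ₛₗ[σ] V}

theorem disjoint_eigenspace_ker [RingHomInvPair σ σ] {t : F} (ht : t ≠ 0) :
    Disjoint (Module.End.eigenspace (f.comp f) t) (LinearMap.ker f) := by
  refine Submodule.disjoint_def.2 fun u hu hfu => ?_
  rw [Module.End.mem_eigenspace_iff, LinearMap.comp_apply, LinearMap.mem_ker.1 hfu,
    map_zero] at hu
  exact (smul_eq_zero.1 hu.symm).resolve_left ht

theorem eigenspace_sup_ker_le [RingHomInvPair σ σ] (t : F) :
    Module.End.eigenspace (f.comp f) t ⊔ LinearMap.ker f ≤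
      LinearMap.ker (f.comp (f.comp f - t • LinearMap.id)) := by
  refine sup_le (fun u hu => ?_) fun u hu => ?_
  · have hffu : f (f u) = t • u := Module.End.mem_eigenspace_iff.1 hu
    simp [hffu]
  · simp [LinearMap.mem_ker.1 hu]

theorem isAlt_comp_comp_sub_smul [RingHomInvPair σ σ] (hη : η.IsSymm) (hf : (η.comp f).IsAlt)
    (t : F) : (η.comp (f.comp (f.comp f - t • LinearMap.id))).IsAlt := by
  intro u
  have hsq : η (f (f (f u))) u = 0 := hf.isRefl _ _ (apply_map_self_eq_zero hη hf (f u))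
  have hself : η (f u) u = 0 := hf u
  simp [map_sub, hsq, hself]

theorem radical_range_eq_bot_of_range_le_eigenspace [RingHomInvPair σ σ]
    (hnd : η.SeparatingLeft) (hf : (η.comp f).IsAlt) {t : F} (ht : t ≠ 0)
    (hsq : LinearMap.range f ≤ Module.End.eigenspace (f.comp f) t) :
    radical η (LinearMap.range f) = ⊥ := by
  rw [radical, orthogonalBilin_range hnd hf]
  exact ((disjoint_eigenspace_ker ht).mono_left hsq).eq_bot

variable {q : ℕ} [IsFrobeniusInvolution q σ] [Finite V]

theorem range_le_eigenspace_of_lt_ncard_fixedVectors (hη : η.IsSymm) (hnd : η.SeparatingLeft)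
    (hf : (η.comp f).IsAlt) {k : ℕ} (hr : finrank F (LinearMap.range f) ≤ k + 2) {c : F}
    (hc : c ≠ 0) (hk : q ^ k < (fixedVectors f c).ncard) :
    LinearMap.range f ≤ Module.End.eigenspace (f.comp f) (σ c * c) := by
  set t := σ c * c with ht
  let E := Module.End.eigenspace (f.comp f) t
  let g : V →ₗ[F] V := f.comp f - t • LinearMap.id
  have hkE : k < finrank F E := (Nat.pow_lt_pow_iff_right (IsFrobeniusInvolution.two_le σ)).1
    (hk.trans_le (ncard_fixedVectors_le hc (fixedVectors_subset_eigenspace c)))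
  have hle : E ⊔ LinearMap.ker f ≤ LinearMap.ker (f.comp g) := eigenspace_sup_ker_le t
  have hsup := Submodule.finrank_sup_add_finrank_inf_eq E (LinearMap.ker f)
  rw [(disjoint_eigenspace_ker (mul_ne_zero ((map_ne_zero σ).2 hc) hc)).eq_bot, finrank_bot] at hsup
  have halt : (η.comp (f.comp g)).IsAlt := isAlt_comp_comp_sub_smul hη hf t
  have hzero : LinearMap.range (f.comp g) = ⊥ := by
    have hker := Submodule.finrank_mono hle
    have hdim := finrank_range_add_finrank_ker hnd hf
    have hdim' := finrank_range_add_finrank_ker hnd halt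
    have heven := even_finrank_range hnd halt
    rw [Nat.even_iff] at heven
    exact Submodule.finrank_eq_zero.1 (by omega)
  rintro _ ⟨u, rfl⟩
  have hu : f (f (f u) - t • u) = 0 := LinearMap.congr_fun (LinearMap.range_eq_bot.1 hzero) u
  have hσt : σ t = t := by
    rw [ht, map_mul, ← RingHom.comp_apply, RingHomCompTriple.comp_eq, RingHom.id_apply, mul_comm]
  rw [Module.End.mem_eigenspace_iff, LinearMap.comp_apply]
  rwa [map_sub, map_smulₛₗ, hσt, sub_eq_zero] at hu

theorem ncard_eigenVectors_le_of_finrank_eq_four (hnd : η.SeparatingLeft)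
    (hf : (η.comp f).IsAlt) (hV : finrank F V = 4) (hr : 2 ≤ finrank F (LinearMap.range f)) :
    ((eigenVectors η f).ncard : ℤ) ≤ 1 + (q + 1) * (q ^ 4 - 1) := by
  have hq : (2 : ℤ) ≤ q := by exact_mod_cast IsFrobeniusInvolution.two_le σ
  have hdim := finrank_range_add_finrank_ker hnd hf
  have heven := Nat.even_iff.1 (even_finrank_range hnd hf)
  obtain hr | hr : finrank F (LinearMap.range f) = 2 ∨ finrank F (LinearMap.ker f) = 0 := by omega
  · have hle := ncard_eigenVectors_le_pow (η := η) (f := f)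
    rw [hr, show finrank F (LinearMap.ker f) = 2 by omega] at hle
    refine hle.trans (sub_nonneg.1 ?_)
    have hgap : (0 : ℤ) ≤ (q - 1) * (q ^ 4 + (2 * q + 1)) :=
      mul_nonneg (by linarith) (by positivity)
    refine hgap.trans_eq ?_
    ring
  · exact ncard_eigenVectors_le_of_ker_eq_bot (k := 3) hV (Submodule.finrank_eq_zero.1 hr)

theorem ncard_eigenVectors_le_of_finrank_eq_six (hnd : η.SeparatingLeft)
    (hf : (η.comp f).IsAlt) (hV : finrank F V = 6) (hr : 4 ≤ finrank F (LinearMap.range f)) :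
    ((eigenVectors η f).ncard : ℤ) ≤ 1 + (q + 1) * (q ^ 6 - 1) := by
  have hq : (2 : ℤ) ≤ q := by exact_mod_cast IsFrobeniusInvolution.two_le σ
  have hdim := finrank_range_add_finrank_ker hnd hf
  have heven := Nat.even_iff.1 (even_finrank_range hnd hf)
  obtain hr | hr : finrank F (LinearMap.range f) = 4 ∨ finrank F (LinearMap.ker f) = 0 := by omega
  · have hle := ncard_eigenVectors_le_pow (η := η) (f := f)
    rw [hr, show finrank F (LinearMap.ker f) = 2 by omega] at hle
    refine hle.trans (sub_nonneg.1 ?_)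
    have hgap : (0 : ℤ) ≤ q * (q ^ 6 - 1) + (q ^ 2 - 1) :=
      add_nonneg (mul_nonneg (by linarith) (sub_nonneg.2 (one_le_pow₀ (by linarith))))
        (sub_nonneg.2 (one_le_pow₀ (by linarith)))
    refine hgap.trans_eq ?_
    ring
  · exact ncard_eigenVectors_le_of_ker_eq_bot (k := 5) hV (Submodule.finrank_eq_zero.1 hr)

theorem genericMinDist_mul_le_of_range_le_eigenspace (hη : η.IsSymm) (hnd : η.SeparatingLeft)
    (hf : (η.comp f).IsAlt) (hV : finrank F V = 5) (hr : finrank F (LinearMap.range f) = 4)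
    {t : F} (ht : t ≠ 0) (hsq : LinearMap.range f ≤ Module.End.eigenspace (f.comp f) t) :
    genericMinDist q 1 * (q ^ 4 - 1) ≤ scaledWeight η f q 1 := by
  have hdim := finrank_range_add_finrank_ker hnd hf
  have hρ : finrank F (radical η (LinearMap.range f)) = 0 := by
    rw [radical_range_eq_bot_of_range_le_eigenspace hnd hf ht hsq, finrank_bot]
  have hE := ncard_eigenVectors_le_of_range_le_eigenspace (η := η) ht hsq fun c hc =>
    ncard_fixedVectors_le hc (fixedVectors_subset_range (f := f) hc)
  rw [hr, ncard_isotropicVectors hη (d := 0) (by omega) (radical_range hη hnd hf ▸ hρ)] at hE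
  have hesc := ncard_escapingVectors_add_ncard_le (η := η) (f := f)
    (S := isotropicVectors η (LinearMap.range f)) fun u ⟨hu, huu⟩ => ⟨huu, by
      have hswap : -η (f u) (f u) = η (f (f u)) u := hf.neg u (f u)
      have hffu : f (f u) = t • u := Module.End.mem_eigenspace_iff.1 (hsq hu)
      rwa [hffu, map_smulₛₗ, LinearMap.smul_apply, huu, smul_zero, neg_eq_zero] at hswap⟩
  zify at hesc
  rw [ncard_isotropicVectors hη (d := 3) hr hρ,
    ncard_isotropicVectors_top hη hnd (d := 4) hV] at hesc
  refine le_of_eq_of_le ?_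
    (le_scaledWeight_of_odd hη hnd hV odd_one hE (le_sub_iff_add_le.2 hesc))
  rw [genericMinDist_of_odd odd_one]
  ring

theorem genericMinDist_mul_le_of_finrank_eq_five (hη : η.IsSymm) (hnd : η.SeparatingLeft)
    (hf : (η.comp f).IsAlt) (hV : finrank F V = 5) (hr : finrank F (LinearMap.range f) = 4) :
    genericMinDist q 1 * (q ^ 4 - 1) ≤ scaledWeight η f q 1 := by
  by_cases! hlarge : ∃ c ≠ 0, q ^ 2 < (fixedVectors f c).ncard
  · obtain ⟨c, hc, hck⟩ := hlarge
    exact genericMinDist_mul_le_of_range_le_eigenspace hη hnd hf hV hr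
      (mul_ne_zero ((map_ne_zero σ).2 hc) hc)
      (range_le_eigenspace_of_lt_ncard_fixedVectors hη hnd hf hr.le hc hck)
  · have hdim := finrank_range_add_finrank_ker hnd hf
    have hE := ncard_eigenVectors_le_of_forall_ncard_fixedVectors_le (η := η) hlarge
    have hker := ncard_isotropicVectors_le (η := η) (LinearMap.ker f)
    rw [show finrank F (LinearMap.ker f) = 1 by omega] at hker
    zify at hker
    have hq : (1 : ℤ) ≤ q := by exact_mod_cast one_le_two.trans (IsFrobeniusInvolution.two_le σ)
    have hq2 : (1 : ℤ) ≤ q ^ 2 := one_le_pow₀ hq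
    refine genericMinDist_mul_le_scaledWeight hη hnd hV ?_
    linear_combination hE + hker + hq2

end SmallDimension

section LowerBound

variable {F V : Type*} [Field F] [AddCommGroup V] [Module F V] {σ : F →+* F}
  {η : V →ₛₗ[σ] V →ₗ[F] F} {f : V →ₛₗ[σ] V} {q n : ℕ} [IsFrobeniusInvolution q σ] [Finite V]

theorem minDist_mul_le_scaledWeight (hη : η.IsSymm) (hnd : η.SeparatingLeft)
    (hf : (η.comp f).IsAlt) (hV : finrank F V = n + 4) (hf₀ : f ≠ 0) :
    minDist q n * (q ^ 4 - 1) ≤ scaledWeight η f q n := by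
  have hq : (1 : ℤ) ≤ q := by exact_mod_cast one_le_two.trans (IsFrobeniusInvolution.two_le σ)
  have hdim := finrank_range_add_finrank_ker hnd hf
  have heven := Nat.even_iff.1 (even_finrank_range hnd hf)
  have hr₀ : finrank F (LinearMap.range f) ≠ 0 := fun h =>
    hf₀ (LinearMap.range_eq_bot.1 (Submodule.finrank_eq_zero.1 h))
  obtain rfl | hn := Nat.eq_zero_or_pos n
  · refine le_of_eq_of_le ?_ (le_scaledWeight_of_even hη hnd hV Even.zero
      (ncard_eigenVectors_le_of_finrank_eq_four hnd hf hV (by omega)))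
    rw [minDist_of_eq_zero_or_eq_two (Or.inl rfl)]
    ring
  obtain hr | hr : finrank F (LinearMap.range f) = 2 ∨ 4 ≤ finrank F (LinearMap.range f) := by omega
  · exact (mul_le_mul_of_nonneg_right (minDist_le_genericMinDist q n)
      (sub_nonneg.2 (one_le_pow₀ hq))).trans
      (genericMinDist_mul_le_of_finrank_range_eq_two hη hnd hf hV hn hr)
  obtain rfl | rfl | hn : n = 1 ∨ n = 2 ∨ 3 ≤ n := by omega
  · rw [minDist_of_not (by decide)]
    exact genericMinDist_mul_le_of_finrank_eq_five hη hnd hf hV (by omega)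
  · refine le_of_eq_of_le ?_ (le_scaledWeight_of_even hη hnd hV even_two
      (ncard_eigenVectors_le_of_finrank_eq_six hnd hf hV hr))
    rw [minDist_of_eq_zero_or_eq_two (Or.inr rfl)]
    ring
  · rw [minDist_of_not (by omega)]
    exact genericMinDist_mul_le_scaledWeight_of_four_le_rank hη hnd hf hV hn hr

end LowerBound

section WedgeMap

variable {F V : Type*} [Field F] [AddCommGroup V] [Module F V] {σ : F →+* F}
  {η : V →ₛₗ[σ] V →ₗ[F] F} {a b : V}

/-- The semilinear map `f` for which `η (f u) v` is the alternating form `η a ∧ η b`. -/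
def wedgeMap (η : V →ₛₗ[σ] V →ₗ[F] F) (a b : V) : V →ₛₗ[σ] V where
  toFun u := σ (η a u) • b - σ (η b u) • a
  map_add' u v := by simp only [map_add]; module
  map_smul' c u := by simp only [map_smul, smul_eq_mul, map_mul]; module

theorem wedgeMap_apply (u : V) : wedgeMap η a b u = σ (η a u) • b - σ (η b u) • a := rfl

theorem apply_wedgeMap_apply [RingHomInvPair σ σ] (u v : V) :
    η (wedgeMap η a b u) v = η a u * η b v - η b u * η a v := by
  simp [wedgeMap_apply]

theorem isAlt_comp_sum_wedgeMap [RingHomInvPair σ σ] {ι : Type*} (s : Finset ι) (a b : ι → V) :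
    (η.comp (∑ i ∈ s, wedgeMap η (a i) (b i))).IsAlt := fun u => by
  simp [LinearMap.sum_apply, apply_wedgeMap_apply, mul_comm]

theorem isAlt_comp_wedgeMap [RingHomInvPair σ σ] : (η.comp (wedgeMap η a b)).IsAlt := fun u => by
  simp [apply_wedgeMap_apply, mul_comm]

theorem wedgeMap_ne_zero (hnd : η.SeparatingLeft) (hab : LinearIndependent F ![a, b]) :
    wedgeMap η a b ≠ 0 := fun h₀ => by
  refine hab.ne_zero 0 (hnd a fun u => ?_)
  have hu : -σ (η b u) • a + σ (η a u) • b = 0 := by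
    have := LinearMap.congr_fun h₀ u
    rw [wedgeMap_apply, LinearMap.zero_apply] at this
    linear_combination (norm := module) this
  exact (map_eq_zero σ).1 (LinearIndependent.pair_iff.1 hab _ _ hu).2

theorem isotropicVectors_subset_eigenVectors_wedgeMap :
    isotropicVectors η ((Submodule.span F {a, b}).orthogonalBilin η) ⊆
      eigenVectors η (wedgeMap η a b) := by
  rintro u ⟨hu, huu⟩
  obtain ⟨hau, hbu⟩ := mem_orthogonalBilin_span_pair.1 hu
  exact ⟨huu, 0, by simp [wedgeMap_apply, hau, hbu]⟩

theorem sdiff_subset_escapingVectors_wedgeMap [RingHomInvPair σ σ] (hη : η.IsSymm)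
    (haa : η a a = 0) (hab : η a b = 0) (hbb : η b b ≠ 0) :
    isotropicVectors η ⊤ \ isotropicVectors η ((F ∙ a).orthogonalBilin η) ⊆
      escapingVectors η (wedgeMap η a b) := by
  rintro u ⟨⟨-, huu⟩, hu⟩
  refine ⟨huu, fun h₀ => hu ⟨mem_orthogonalBilin_span_singleton.2 ?_, huu⟩⟩
  simpa [apply_wedgeMap_apply, wedgeMap_apply, haa, hab, hbb, hη.isRefl _ _ hab] using h₀

end WedgeMap

section Existence

variable {F V : Type*} [Field F] [AddCommGroup V] [Module F V] {σ : F →+* F}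
  {η : V →ₛₗ[σ] V →ₗ[F] F} {n : ℕ}

theorem exists_apply_self_ne_zero {q : ℕ} [IsFrobeniusInvolution q σ] {W : Submodule F V}
    (hW : ¬W ≤ W.orthogonalBilin η) :
    ∃ w ∈ W, η w w ≠ 0 := by
  contrapose! hW
  exact fun x hx y hy => apply_eq_zero_of_forall_apply_self hW hy hx

theorem exists_apply_self_eq_one {q : ℕ} [IsFrobeniusInvolution q σ] (hη : η.IsSymm)
    {W : Submodule F V} (hW : ¬W ≤ W.orthogonalBilin η) : ∃ w ∈ W, η w w = 1 := by
  have := IsFrobeniusInvolution.finite σ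
  obtain ⟨w, hw, hww⟩ := exists_apply_self_ne_zero hW
  have hσ : σ (η w w)⁻¹ = (η w w)⁻¹ := by rw [map_inv₀, hη.eq w w]
  obtain ⟨a, ha : σ a * a = (η w w)⁻¹⟩ : {a : F | σ a * a = (η w w)⁻¹}.Nonempty := by
    rw [← Set.ncard_pos, IsFrobeniusInvolution.ncard_setOf_mul_eq (inv_ne_zero hww) hσ]
    exact q.succ_pos
  refine ⟨a • w, W.smul_mem a hw, ?_⟩
  rw [map_smul, map_smulₛₗ, LinearMap.smul_apply, smul_smul, mul_comm a, ha, smul_eq_mul,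
    inv_mul_cancel₀ hww]

variable [Finite V]

theorem exists_isotropic_ne_zero {q : ℕ} [IsFrobeniusInvolution q σ] (hη : η.IsSymm)
    (hnd : η.SeparatingLeft) (hV : finrank F V = n + 2) : ∃ a : V, a ≠ 0 ∧ η a a = 0 := by
  have hq : (2 : ℤ) ≤ q := by exact_mod_cast IsFrobeniusInvolution.two_le σ
  have hone : (1 : ℤ) < (isotropicVectors η ⊤).ncard := by
    rw [ncard_isotropicVectors_top hη hnd (d := n + 1) hV]
    have hsign : (-1 : ℤ) ^ (n + 1) ≤ 1 := (le_abs_self _).trans_eq (by simp)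
    have hpow : (q : ℤ) ^ 1 ≤ q ^ (n + 2) := pow_le_pow_right₀ (by linarith) (by omega)
    have hpow' : (1 : ℤ) < q ^ (n + 1) := one_lt_pow₀ (by linarith) (by omega)
    calc (1 : ℤ) < q ^ (n + 1) * 1 := by linarith
      _ ≤ q ^ (n + 1) * (q ^ (n + 2) - (-1) ^ (n + 1) * (q - 1)) :=
        mul_le_mul_of_nonneg_left (by nlinarith) (by linarith)
      _ = (q : ℤ) ^ (2 * (n + 1) + 1) - (-1) ^ (n + 1) * (q - 1) * q ^ (n + 1) := by ring
  obtain ⟨a, ha, ha₀⟩ := Set.exists_ne_of_one_lt_ncard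
    (s := isotropicVectors η ⊤) (by exact_mod_cast hone) 0
  exact ⟨a, ha₀, ha.2⟩

theorem exists_isotropic_orthogonal_notMem_span {q : ℕ} [IsFrobeniusInvolution q σ]
    (hη : η.IsSymm) (hnd : η.SeparatingLeft)
    (hV : finrank F V = n + 4) {a : V} (ha : a ≠ 0) (haa : η a a = 0) :
    ∃ b ∉ F ∙ a, η a b = 0 ∧ η b b = 0 := by
  have hq : (2 : ℤ) ≤ q := by exact_mod_cast IsFrobeniusInvolution.two_le σ
  have hlt : ((F ∙ a : Submodule F V) : Set V).ncard <
      (isotropicVectors η ((F ∙ a).orthogonalBilin η)).ncard := by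
    rw [IsFrobeniusInvolution.ncard_submodule σ, finrank_span_singleton ha]
    zify
    rw [ncard_isotropicVectors_orthogonalBilin_singleton hη hnd (d := n + 2) hV ha haa]
    have hsign : (-1 : ℤ) ≤ (-1) ^ (n + 2) := (neg_le_of_abs_le (by simp))
    have hpow : (q : ℤ) ^ 1 ≤ q ^ (n + 2) := pow_le_pow_right₀ (by linarith) (by omega)
    calc (q : ℤ) ^ (2 * 1) < q ^ (n + 3) := pow_lt_pow_right₀ (by linarith) (by omega)
      _ = (q : ℤ) ^ (n + 3) * 1 := (mul_one _).symm
      _ ≤ q ^ (n + 3) * (q ^ (n + 2) + (-1) ^ (n + 2) * (q - 1)) :=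
        mul_le_mul_of_nonneg_left (by nlinarith) (by positivity)
      _ = (q : ℤ) ^ (2 * (n + 2) + 1) + (-1) ^ (n + 2) * (q - 1) * q ^ (n + 2 + 1) := by ring
  obtain ⟨b, hb, hba⟩ := Set.exists_mem_notMem_of_ncard_lt_ncard hlt
  exact ⟨b, hba, mem_orthogonalBilin_span_singleton.1 hb.1, hb.2⟩

theorem exists_anisotropic_orthogonal {q : ℕ} [IsFrobeniusInvolution q σ] (hη : η.IsSymm)
    (hnd : η.SeparatingLeft) (hV : 3 ≤ finrank F V) (a : V) : ∃ b, η a b = 0 ∧ η b b ≠ 0 := by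
  have hle : ¬(F ∙ a).orthogonalBilin η ≤ ((F ∙ a).orthogonalBilin η).orthogonalBilin η := by
    rw [orthogonalBilin_orthogonalBilin hnd hη.isRefl]
    intro hle
    have hdim := finrank_add_finrank_orthogonalBilin hnd (F ∙ a)
    have hspan := finrank_span_le_card (R := F) ({a} : Set V)
    rw [Set.toFinset_singleton, Finset.card_singleton] at hspan
    have := Submodule.finrank_mono hle
    omega
  obtain ⟨b, hb, hbb⟩ := exists_apply_self_ne_zero hle
  exact ⟨b, mem_orthogonalBilin_span_singleton.1 hb, hbb⟩

end Existence

section Orthonormal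

variable {F V ι : Type*} [Field F] [AddCommGroup V] [Module F V] {σ : F →+* F}
  {η : V →ₛₗ[σ] V →ₗ[F] F}

/-- A family of vectors that is orthonormal for the sesquilinear form `η`. -/
def IsOrthonormal (η : V →ₛₗ[σ] V →ₗ[F] F) (v : ι → V) : Prop :=
  (Pairwise fun i j => η (v i) (v j) = 0) ∧ ∀ i, η (v i) (v i) = 1

namespace IsOrthonormal

variable {v : ι → V}

theorem apply_eq_ite [DecidableEq ι] (hv : IsOrthonormal η v) (i j : ι) :
    η (v i) (v j) = if i = j then 1 else 0 := by
  split_ifs with h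
  · rw [h, hv.2]
  · exact hv.1 h

theorem comp {κ : Type*} (hv : IsOrthonormal η v) {e : κ → ι} (he : Function.Injective e) :
    IsOrthonormal η (v ∘ e) :=
  ⟨fun _ _ hij => hv.1 (he.ne hij), fun i => hv.2 (e i)⟩

theorem cons (hη : η.IsSymm) {k : ℕ} {v : Fin k → V} (hv : IsOrthonormal η v) {w : V}
    (hvw : ∀ i, η (v i) w = 0) (hww : η w w = 1) :
    IsOrthonormal η (Fin.cons w v : Fin (k + 1) → V) := by
  refine ⟨fun i j hij => ?_, Fin.cases (by simpa) (by simpa using hv.2)⟩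
  cases i using Fin.cases <;> cases j using Fin.cases
  · exact absurd rfl hij
  · simpa using hη.isRefl _ _ (hvw _)
  · simpa using hvw _
  · simpa using hv.1 fun h => hij (congrArg Fin.succ h)

theorem apply_sum [Fintype ι] (hv : IsOrthonormal η v) (c : ι → F) (i : ι) :
    η (v i) (∑ j, c j • v j) = c i := by
  classical
  simp [hv.apply_eq_ite]

theorem linearIndependent [Finite ι] (hv : IsOrthonormal η v) : LinearIndependent F v :=
  have := Fintype.ofFinite ι
  Fintype.linearIndependent_iff.2 fun c hc i => by rw [← hv.apply_sum c i, hc, map_zero]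

theorem radical_span_eq_bot [Finite ι] (hv : IsOrthonormal η v) :
    radical η (Submodule.span F (Set.range v)) = ⊥ := by
  have := Fintype.ofFinite ι
  refine (Submodule.eq_bot_iff _).2 fun x hx => ?_
  obtain ⟨c, rfl⟩ := (Submodule.mem_span_range_iff_exists_fun F).1 hx.1
  refine Finset.sum_eq_zero fun i _ => ?_
  rw [← hv.apply_sum c i, hx.2 (v i) (Submodule.subset_span ⟨i, rfl⟩), zero_smul]

theorem sum_apply_smul [Fintype ι] [FiniteDimensional F V] (hv : IsOrthonormal η v)
    (hι : Fintype.card ι = finrank F V) (u : V) : ∑ i, η (v i) u • v i = u := by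
  have hu : u ∈ Submodule.span F (Set.range v) :=
    hv.linearIndependent.span_eq_top_of_card_eq_finrank' hι ▸ Submodule.mem_top
  obtain ⟨c, rfl⟩ := (Submodule.mem_span_range_iff_exists_fun F).1 hu
  simp_rw [hv.apply_sum c]

end IsOrthonormal

theorem exists_isOrthonormal {q : ℕ} [IsFrobeniusInvolution q σ] [Finite V] (hη : η.IsSymm)
    (hnd : η.SeparatingLeft) {k : ℕ} (hk : k ≤ finrank F V) :
    ∃ v : Fin k → V, IsOrthonormal η v := by
  induction k with
  | zero => exact ⟨Fin.elim0, fun i => i.elim0, fun i => i.elim0⟩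
  | succ k ih =>
    obtain ⟨v, hv⟩ := ih (by omega)
    set S := Submodule.span F (Set.range v)
    have hS : ¬S.orthogonalBilin η ≤ (S.orthogonalBilin η).orthogonalBilin η := fun hle => by
      rw [orthogonalBilin_orthogonalBilin hnd hη.isRefl] at hle
      have hbot : S.orthogonalBilin η = ⊥ :=
        (inf_eq_right.2 hle).symm.trans hv.radical_span_eq_bot
      have hdim := finrank_add_finrank_orthogonalBilin hnd S
      rw [finrank_span_eq_card hv.linearIndependent, Fintype.card_fin, hbot, finrank_bot] at hdim
      omega
    obtain ⟨w, hw, hww⟩ := exists_apply_self_eq_one hη hS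
    exact ⟨_, hv.cons hη (fun i => hw _ (Submodule.subset_span ⟨i, rfl⟩)) hww⟩

theorem exists_comp_self_eq_neg {q : ℕ} [IsFrobeniusInvolution q σ] [Finite V] (hη : η.IsSymm)
    (hnd : η.SeparatingLeft) (hV : Even (finrank F V)) :
    ∃ f : V →ₛₗ[σ] V, (η.comp f).IsAlt ∧ ∀ u, f (f u) = -u := by
  obtain ⟨k, hk⟩ := hV
  obtain ⟨v, hv⟩ := exists_isOrthonormal hη hnd hk.ge
  let w : Fin k ⊕ Fin k → V := v ∘ finSumFinEquiv
  have hw : IsOrthonormal η w := hv.comp finSumFinEquiv.injective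
  let f : V →ₛₗ[σ] V := ∑ i, wedgeMap η (w (.inl i)) (w (.inr i))
  have hf (u : V) : f u = ∑ i, (σ (η (w (.inl i)) u) • w (.inr i) -
      σ (η (w (.inr i)) u) • w (.inl i)) := LinearMap.sum_apply _ _ _
  have hσσ (x : F) : σ (σ x) = x := RingHomInvPair.comp_apply_eq
  have hinl (u : V) (j : Fin k) : η (w (.inl j)) (f u) = -σ (η (w (.inr j)) u) := by
    simp [hf, hw.apply_eq_ite]
  have hinr (u : V) (j : Fin k) : η (w (.inr j)) (f u) = σ (η (w (.inl j)) u) := by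
    simp [hf, hw.apply_eq_ite]
  refine ⟨f, isAlt_comp_sum_wedgeMap _ _ _, fun u => ?_⟩
  have hexp := hw.sum_apply_smul (by simp [hk]) u
  rw [Fintype.sum_sum_type, ← Finset.sum_add_distrib] at hexp
  rw [hf, ← neg_inj, neg_neg]
  refine Eq.trans ?_ hexp
  rw [← Finset.sum_neg_distrib]
  refine Finset.sum_congr rfl fun i _ => ?_
  rw [hinl, hinr, map_neg, hσσ, hσσ]
  module

end Orthonormal

section FixedVectorsCount

variable {F V : Type*} [Field F] [AddCommGroup V] [Module F V] {σ : F →+* F}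
  {η : V →ₛₗ[σ] V →ₗ[F] F} {f : V →ₛₗ[σ] V} {q : ℕ}

theorem surjOn_add_smul_fixedVectors [RingHomInvPair σ σ] {c : F} (hc : c ≠ 0) {a : F}
    (ha : σ a ≠ a) (hf : ∀ u, f (f u) = (σ c * c) • u) :
    Set.SurjOn (fun p : V × V => p.1 + a • p.2) (fixedVectors f c ×ˢ fixedVectors f c)
      Set.univ := by
  intro w _
  have hca : c * (σ a - a) ≠ 0 := mul_ne_zero hc (sub_ne_zero.2 ha)
  obtain ⟨v, hv⟩ : ∃ v, (c * (σ a - a)) • v = f w - c • w := ⟨_, smul_inv_smul₀ hca _⟩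
  have hfv : f v = c • v := by
    have himage := congrArg f hv
    rw [map_smulₛₗ, map_sub, map_smulₛₗ, hf, map_mul, map_sub,
      RingHomInvPair.comp_apply_eq (x := a)] at himage
    refine smul_right_injective V (mul_ne_zero ((map_ne_zero σ).2 hc)
      (sub_ne_zero.2 (Ne.symm ha))) ?_
    linear_combination (norm := module) himage + σ c • hv
  refine ⟨(w - a • v, v), ⟨?_, hfv⟩, sub_add_cancel _ _⟩
  change f (w - a • v) = c • (w - a • v)
  rw [map_sub, map_smulₛₗ, hfv]
  linear_combination (norm := module) -hv

variable [IsFrobeniusInvolution q σ] [Finite V]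

theorem pow_finrank_le_ncard_fixedVectors {c : F} (hc : c ≠ 0)
    (hf : ∀ u, f (f u) = (σ c * c) • u) : q ^ finrank F V ≤ (fixedVectors f c).ncard := by
  obtain ⟨a, ha⟩ := IsFrobeniusInvolution.exists_apply_ne σ
  have hcard := Set.ncard_le_ncard (surjOn_add_smul_fixedVectors hc ha hf)
  rw [← Submodule.top_coe (R := F), IsFrobeniusInvolution.ncard_submodule σ, finrank_top,
    two_mul, pow_add] at hcard
  exact Nat.mul_self_le_mul_self_iff.1
    (hcard.trans ((Set.ncard_image_le (Set.toFinite _)).trans_eq Set.ncard_prod))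

theorem le_ncard_eigenVectors_of_comp_self (hη : η.IsSymm) (hf : (η.comp f).IsAlt) {t : F}
    (ht : t ≠ 0) (hσt : σ t = t) (hsq : ∀ u, f (f u) = t • u) :
    1 + ((q : ℤ) + 1) * (q ^ finrank F V - 1) ≤ (eigenVectors η f).ncard := by
  have := IsFrobeniusInvolution.finite σ
  set C : Set F := {c | σ c * c = t}
  have hsub : (⋃ c ∈ C, fixedVectors f c \ {0}) ⊆ eigenVectors η f \ {0} := by
    refine Set.iUnion₂_subset fun c hc u ⟨(hu : f u = c • u), hu₀⟩ => ⟨⟨?_, c, hu⟩, hu₀⟩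
    have hufu := apply_map_self_eq_zero hη hf u
    rw [hu, map_smul] at hufu
    exact (smul_eq_zero.1 hufu).resolve_left (right_ne_zero_of_mul (hc.trans_ne ht))
  have hdisj : C.PairwiseDisjoint fun c => fixedVectors f c \ {0} := fun c _ c' _ hcc' =>
    Set.disjoint_left.2 fun u ⟨hu, hu₀⟩ ⟨hu', _⟩ =>
      hcc' (smul_left_injective F hu₀ (hu.symm.trans hu'))
  have hfix : ∀ c ∈ C, (q : ℤ) ^ finrank F V - 1 ≤ (fixedVectors f c \ {0}).ncard := fun c hc => by
    have hzero : (0 : V) ∈ fixedVectors f c := by simp [fixedVectors]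
    have hcard := Set.ncard_sdiff_singleton_add_one hzero
    have hle := pow_finrank_le_ncard_fixedVectors (f := f)
      (right_ne_zero_of_mul (hc.trans_ne ht)) fun u => by rw [hsq, hc]
    zify at hcard hle
    linarith
  have hC : C.ncard = q + 1 := IsFrobeniusInvolution.ncard_setOf_mul_eq ht hσt
  have heig := Set.ncard_sdiff_singleton_add_one (zero_mem_eigenVectors (η := η) (f := f))
  have hle := Set.ncard_le_ncard hsub
  have hunion : ((q : ℤ) + 1) * (q ^ finrank F V - 1) ≤
      (⋃ c ∈ C, fixedVectors f c \ {0}).ncard := by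
    rw [C.toFinite.ncard_biUnion (fun _ _ => Set.toFinite _) hdisj,
      finsum_mem_eq_finite_toFinset_sum _ C.toFinite, Nat.cast_sum]
    refine Eq.trans_le ?_ (Finset.card_nsmul_le_sum _ _ _ fun c hc => hfix c (by simpa using hc))
    rw [nsmul_eq_mul, ← Set.ncard_eq_toFinset_card C, hC, Nat.cast_succ]
  zify at heig hle
  linarith

end FixedVectorsCount

section LightForms

variable {F V : Type*} [Field F] [AddCommGroup V] [Module F V] {σ : F →+* F}
  {η : V →ₛₗ[σ] V →ₗ[F] F} {f : V →ₛₗ[σ] V} {q n : ℕ}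
  [IsFrobeniusInvolution q σ] [Finite V] {E D : ℤ}

theorem scaledWeight_le_of_even (hη : η.IsSymm) (hnd : η.SeparatingLeft)
    (hV : finrank F V = n + 4) (hn : Even n) (hE : E ≤ (eigenVectors η f).ncard)
    (hf : ∀ u, η u u = 0 → η (f u) (f u) = 0) :
    scaledWeight η f q n ≤ q ^ (2 * n + 1) * (q ^ (2 * n + 7) + (q - 1) * q ^ (n + 3) - E) := by
  have hesc : escapingVectors η f = ∅ :=
    Set.eq_empty_of_forall_notMem fun u hu => hu.2 (hf u hu.1)
  rw [scaledWeight, ncard_isotropicVectors_top hη hnd (d := n + 3) hV, hesc, Set.ncard_empty,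
    hn.add_odd (by decide : Odd 3) |>.neg_one_pow]
  have heig := mul_le_mul_of_nonneg_left hE (by positivity : (0 : ℤ) ≤ q ^ (2 * n + 1))
  push_cast
  linear_combination heig

theorem scaledWeight_le_of_odd (hη : η.IsSymm) (hnd : η.SeparatingLeft)
    (hV : finrank F V = n + 4) (hn : Odd n) (hE : E ≤ (eigenVectors η f).ncard)
    (hD : D ≤ (escapingVectors η f).ncard) :
    scaledWeight η f q n ≤
      q ^ (2 * n + 1) * (q ^ (2 * n + 7) - (q - 1) * q ^ (n + 3) - E) - q ^ n * D := by
  rw [scaledWeight, ncard_isotropicVectors_top hη hnd (d := n + 3) hV, hn.neg_one_pow,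
    hn.add_odd (by decide : Odd 3) |>.neg_one_pow]
  have hesc := mul_le_mul_of_nonneg_left hD (by positivity : (0 : ℤ) ≤ q ^ n)
  have heig := mul_le_mul_of_nonneg_left hE (by positivity : (0 : ℤ) ≤ q ^ (2 * n + 1))
  linear_combination hesc + heig

theorem exists_scaledWeight_le_of_even (hη : η.IsSymm) (hnd : η.SeparatingLeft)
    (hV : finrank F V = n + 4) (hn : Even n) :
    ∃ f ≠ 0, (η.comp f).IsAlt ∧ scaledWeight η f q n ≤ genericMinDist q n * (q ^ 4 - 1) := by
  obtain ⟨a, ha, haa⟩ := exists_isotropic_ne_zero hη hnd (n := n + 2) hV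
  obtain ⟨b, hba, hab, hbb⟩ := exists_isotropic_orthogonal_notMem_span hη hnd hV ha haa
  have hli := linearIndependent_pair_of_notMem ha hba
  have hba' := hη.isRefl _ _ hab
  refine ⟨wedgeMap η a b, wedgeMap_ne_zero hnd hli, isAlt_comp_wedgeMap, ?_⟩
  have hI := ncard_isotropicVectors_orthogonalBilin hη hnd (d := n + 1)
    (by rw [hV, finrank_span_pair hli])
    (finrank_radical_span_pair_of_isotropic hη.isRefl hli haa hbb hab)
  have hE : ((isotropicVectors η ((Submodule.span F {a, b}).orthogonalBilin η)).ncard : ℤ) ≤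
      (eigenVectors η (wedgeMap η a b)).ncard := by
    exact_mod_cast Set.ncard_le_ncard isotropicVectors_subset_eigenVectors_wedgeMap
  refine (scaledWeight_le_of_even hη hnd hV hn hE fun u _ => ?_).trans_eq ?_
  · simp [wedgeMap_apply, haa, hab, hbb, hba']
  · rw [hI, genericMinDist_of_even hn, hn.add_odd (by decide : Odd 3) |>.neg_one_pow]
    ring

theorem exists_scaledWeight_le_of_odd (hη : η.IsSymm) (hnd : η.SeparatingLeft)
    (hV : finrank F V = n + 4) (hn : Odd n) :
    ∃ f ≠ 0, (η.comp f).IsAlt ∧ scaledWeight η f q n ≤ genericMinDist q n * (q ^ 4 - 1) := by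
  obtain ⟨a, ha, haa⟩ := exists_isotropic_ne_zero hη hnd (n := n + 2) hV
  obtain ⟨b, hab, hbb⟩ := exists_anisotropic_orthogonal hη hnd (by omega) a
  have hli := linearIndependent_pair_of_anisotropic ha hη.isRefl hab hbb
  refine ⟨wedgeMap η a b, wedgeMap_ne_zero hnd hli, isAlt_comp_wedgeMap, ?_⟩
  have hIab := ncard_isotropicVectors_orthogonalBilin hη hnd (d := n + 1)
    (by rw [hV, finrank_span_pair hli])
    (finrank_radical_span_pair_of_anisotropic hη.isRefl ha haa hbb hab)
  have hIa := ncard_isotropicVectors_orthogonalBilin_singleton hη hnd (d := n + 2) hV ha haa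
  have hI := ncard_isotropicVectors_top hη hnd (d := n + 3) hV
  have hdiff := Set.ncard_sdiff_add_ncard_of_subset
    (isotropicVectors_mono (η := η) (le_top : (F ∙ a).orthogonalBilin η ≤ ⊤))
  have hE : ((isotropicVectors η ((Submodule.span F {a, b}).orthogonalBilin η)).ncard : ℤ) ≤
      (eigenVectors η (wedgeMap η a b)).ncard := by
    exact_mod_cast Set.ncard_le_ncard isotropicVectors_subset_eigenVectors_wedgeMap
  have hD : (q : ℤ) ^ (2 * n + 5) * (q ^ 2 - 1) ≤ (escapingVectors η (wedgeMap η a b)).ncard := by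
    have hle := Set.ncard_le_ncard (sdiff_subset_escapingVectors_wedgeMap hη haa hab hbb)
    zify at hle hdiff
    rw [hn.add_odd (by decide : Odd 3) |>.neg_one_pow] at hI
    rw [hn.add_even even_two |>.neg_one_pow] at hIa
    linear_combination hle - hdiff - hI + hIa
  refine (scaledWeight_le_of_odd hη hnd hV hn hE hD).trans_eq ?_
  rw [hIab, genericMinDist_of_odd hn, (hn.add_odd odd_one).add_odd odd_one |>.neg_one_pow]
  ring

theorem exists_scaledWeight_le_of_eq_zero_or_eq_two (hη : η.IsSymm) (hnd : η.SeparatingLeft)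
    (hV : finrank F V = n + 4) (hn : n = 0 ∨ n = 2) :
    ∃ f ≠ 0, (η.comp f).IsAlt ∧ scaledWeight η f q n ≤ minDist q n * (q ^ 4 - 1) := by
  have heven : Even n := by obtain rfl | rfl := hn <;> decide
  obtain ⟨f, hf, hsq⟩ := exists_comp_self_eq_neg hη hnd (hV ▸ heven.add (by decide))
  have hE := le_ncard_eigenVectors_of_comp_self hη hf (t := -1) (by simp) (by simp)
    fun u => by rw [hsq, neg_one_smul]
  have hne : f ≠ 0 := by
    rintro rfl
    have := Module.nontrivial_of_finrank_pos (R := F) (M := V) (by omega)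
    obtain ⟨u, hu⟩ := exists_ne (0 : V)
    exact hu (neg_eq_zero.1 (hsq u).symm)
  refine ⟨f, hne, hf, (scaledWeight_le_of_even hη hnd hV heven hE fun u hu => ?_).trans_eq ?_⟩
  · simpa [hsq, hu] using hf.neg u (f u)
  · rw [minDist_of_eq_zero_or_eq_two hn, hV]
    obtain rfl | rfl := hn <;> ring

theorem exists_scaledWeight_le (hη : η.IsSymm) (hnd : η.SeparatingLeft)
    (hV : finrank F V = n + 4) :
    ∃ f ≠ 0, (η.comp f).IsAlt ∧ scaledWeight η f q n ≤ minDist q n * (q ^ 4 - 1) := by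
  by_cases hn : n = 0 ∨ n = 2
  · exact exists_scaledWeight_le_of_eq_zero_or_eq_two hη hnd hV hn
  · rw [minDist_of_not hn]
    exact n.even_or_odd.elim (exists_scaledWeight_le_of_even hη hnd hV)
      (exists_scaledWeight_le_of_odd hη hnd hV)

end LightForms

section AlternatingForms

variable {F V : Type*} [Field F] [AddCommGroup V] [Module F V]

/-- An alternating bilinear form as an alternating map in two variables, which is the form in which
the universal property of the exterior square is stated. -/
def toAlternatingMap (B : V →ₗ[F] V →ₗ[F] F) (hB : B.IsAlt) : V [⋀^Fin 2]→ₗ[F] F where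
  toFun m := B (m 0) (m 1)
  map_update_add' m i x y := by fin_cases i <;> simp
  map_update_smul' m i c x := by fin_cases i <;> simp
  map_eq_zero_of_eq' m i j hij hne := by
    have h01 : m 0 = m 1 := by fin_cases i <;> fin_cases j <;> simp_all
    rw [h01, hB]

/-- The alternating bilinear form `(u, v) ↦ φ (u ∧ v)` of a linear functional `φ` on the exterior
square. -/
noncomputable def formOf (φ : Dual F (⋀[F]^2 V)) : V →ₗ[F] V →ₗ[F] F where
  toFun u := (AlternatingMap.ofSubsingleton F V F (0 : Fin 1)).symm
    ((φ.compAlternatingMap (exteriorPower.ιMulti F 2)).curryLeft u)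
  map_add' u u' := by rw [map_add]; rfl
  map_smul' c u := by rw [map_smul]; rfl

theorem formOf_apply (φ : Dual F (⋀[F]^2 V)) (u v : V) :
    formOf φ u v = φ (exteriorPower.ιMulti F 2 ![u, v]) := by
  rw [Matrix.cons_fin_one v]
  rfl

theorem isAlt_formOf (φ : Dual F (⋀[F]^2 V)) : (formOf φ).IsAlt := fun u => by
  rw [formOf_apply, (exteriorPower.ιMulti F 2).map_eq_zero_of_eq ![u, u] (i := 0) (j := 1) rfl
    zero_ne_one, map_zero]

theorem formOf_injective : Function.Injective (formOf (F := F) (V := V)) := fun φ ψ h => by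
  refine exteriorPower.linearMap_ext (AlternatingMap.ext fun m => ?_)
  have hm : m = ![m 0, m 1] := by
    ext i
    fin_cases i <;> rfl
  rw [LinearMap.compAlternatingMap_apply, LinearMap.compAlternatingMap_apply, hm, ← formOf_apply,
    ← formOf_apply, h]

theorem exists_formOf_eq {B : V →ₗ[F] V →ₗ[F] F} (hB : B.IsAlt) : ∃ φ, formOf φ = B := by
  refine ⟨exteriorPower.alternatingMapLinearEquiv (toAlternatingMap B hB), ?_⟩
  ext u v
  rw [formOf_apply, exteriorPower.alternatingMapLinearEquiv_apply_ιMulti]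
  rfl

end AlternatingForms

section Pluecker

variable {F V : Type*} [Field F] [AddCommGroup V] [Module F V] [FiniteDimensional F V]

theorem pluecker_submodule_pair (X : {X : Submodule F V // finrank F X = 2}) {u v : V}
    (hu : u ∈ X.1) (hv : v ∈ X.1) (huv : LinearIndependent F ![u, v]) :
    (pluecker 2 X).submodule = F ∙ exteriorPower.ιMulti F 2 ![u, v] := by
  have hb : X.1.subtype ∘ ![⟨u, hu⟩, ⟨v, hv⟩] = ![u, v] := by
    ext i
    fin_cases i <;> rfl
  have hli : LinearIndependent F ![(⟨u, hu⟩ : X.1), ⟨v, hv⟩] :=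
    LinearIndependent.of_comp X.1.subtype (hb ▸ huv)
  rw [pluecker_submodule 2 X (basisOfLinearIndependentOfCardEqFinrank hli (by simp [X.2])),
    ← hb, coe_basisOfLinearIndependentOfCardEqFinrank]
  rfl

theorem pluecker_submodule_le_ker_iff (X : {X : Submodule F V // finrank F X = 2}) {u v : V}
    (hu : u ∈ X.1) (hv : v ∈ X.1) (huv : LinearIndependent F ![u, v])
    (φ : Dual F (⋀[F]^2 V)) :
    (pluecker 2 X).submodule ≤ LinearMap.ker φ ↔ formOf φ u v = 0 := by
  rw [pluecker_submodule_pair X hu hv huv, Submodule.span_singleton_le_iff_mem, LinearMap.mem_ker,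
    formOf_apply]

theorem le_of_pluecker_eq {X Y : {X : Submodule F V // finrank F X = 2}}
    (h : pluecker 2 X = pluecker 2 Y) : Y.1 ≤ X.1 := by
  intro u' hu'
  by_contra hu'X
  obtain ⟨v', hv', hv'u⟩ := exists_notMem_span_singleton Y.2.ge u'
  have hu'v' : LinearIndependent F ![u', v'] :=
    linearIndependent_pair_of_notMem (by rintro rfl; exact hu'X X.1.zero_mem) hv'u
  obtain ⟨u, hu, v, hv, huv⟩ := exists_linearIndependent_pair_mem X.2.ge
  obtain ⟨α, hα, hαX⟩ := Submodule.exists_le_ker_of_notMem hu'X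
  obtain ⟨β, hβ, hβu⟩ := Submodule.exists_le_ker_of_notMem hv'u
  have hβu' : β u' = 0 := hβu (Submodule.mem_span_singleton_self u')
  -- `α ∧ β` vanishes on `X` but not on `Y`
  obtain ⟨φ, hφ⟩ := exists_formOf_eq (B := α.smulRight β - β.smulRight α)
    (fun x => by simp [mul_comm])
  have hφX : formOf φ u v = 0 := by simp [hφ, LinearMap.mem_ker.1 (hαX hu),
    LinearMap.mem_ker.1 (hαX hv)]
  rw [← pluecker_submodule_le_ker_iff X hu hv huv, h,
    pluecker_submodule_le_ker_iff Y hu' hv' hu'v', hφ] at hφX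
  simp [hβu', hα, hβ] at hφX

theorem pluecker_injective :
    Function.Injective (pluecker 2 : {X : Submodule F V // finrank F X = 2} → _) :=
  fun _ _ h => Subtype.ext (le_antisymm (le_of_pluecker_eq h.symm) (le_of_pluecker_eq h))

end Pluecker

section RepresentativeSystem

variable {F W : Type*} [Field F] [AddCommGroup W] [Module F W] {N : ℕ} {Ω : Set (ℙ F W)}
  {ω : Fin N → W}

theorem IsRepresentativeSystem.ncard_eq (hω : IsRepresentativeSystem Ω ω) : Ω.ncard = N := by
  rw [← hω.bijOn.ncard_eq, Set.ncard_univ, Nat.card_fin]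

theorem IsRepresentativeSystem.ncard_setOf_apply_ne_zero (hω : IsRepresentativeSystem Ω ω)
    (φ : Dual F W) :
    {i | φ (ω i) ≠ 0}.ncard = {P ∈ Ω | ¬ P.submodule ≤ LinearMap.ker φ}.ncard := by
  have hiff (i : Fin N) : ¬ (Projectivization.mk F (ω i) (hω.ne_zero i)).submodule ≤
      LinearMap.ker φ ↔ φ (ω i) ≠ 0 := by
    rw [Projectivization.submodule_mk, Submodule.span_singleton_le_iff_mem, LinearMap.mem_ker]
  refine Set.BijOn.ncard_eq ⟨fun i hi => ⟨hω.bijOn.mapsTo (Set.mem_univ i), (hiff i).2 hi⟩,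
    hω.bijOn.injOn.mono (Set.subset_univ _), ?_⟩
  rintro P ⟨hP, hφ⟩
  obtain ⟨i, -, rfl⟩ := hω.bijOn.surjOn hP
  exact ⟨i, (hiff i).1 hφ, rfl⟩

end RepresentativeSystem

section Code

variable {F W : Type*} [Field F] [AddCommGroup W] [Module F W] {N : ℕ} {ω : Fin N → W}

theorem finrank_projectiveCode (h : ∀ φ : Dual F W, (∀ i, φ (ω i) = 0) → φ = 0) :
    finrank F (projectiveCode (F := F) ω) = finrank F W := by
  rw [projectiveCode, LinearMap.finrank_range_of_inj, Subspace.dual_finrank_eq]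
  exact (injective_iff_map_eq_zero _).2 fun φ hφ => h φ (congrFun hφ)

theorem isMinimumDistance_projectiveCode [DecidableEq F] {d : ℕ} (hd : d ≠ 0)
    (hle : ∀ φ : Dual F W, φ ≠ 0 → d ≤ {i | φ (ω i) ≠ 0}.ncard)
    (hex : ∃ φ : Dual F W, {i | φ (ω i) ≠ 0}.ncard = d) :
    IsMinimumDistance (projectiveCode (F := F) ω) d := by
  have hdist (φ ψ : Dual F W) : hammingDist (fun i => φ (ω i)) (fun i => ψ (ω i)) =
      {i | (φ - ψ) (ω i) ≠ 0}.ncard := by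
    rw [Set.ncard_eq_toFinset_card', hammingDist]
    congr 1
    ext i
    simp [sub_ne_zero]
  constructor
  · obtain ⟨φ, hφ⟩ := hex
    have hdφ : hammingDist (fun i => φ (ω i)) (fun i => (0 : Dual F W) (ω i)) = d := by
      rw [hdist, sub_zero, hφ]
    exact ⟨_, ⟨φ, rfl⟩, _, ⟨0, rfl⟩, hammingDist_ne_zero.1 (hdφ.trans_ne hd), hdφ⟩
  · rintro _ ⟨_, ⟨φ, rfl⟩, _, ⟨ψ, rfl⟩, hne, rfl⟩
    refine (hle (φ - ψ) fun h => hne ?_).trans_eq (hdist φ ψ).symm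
    rw [sub_eq_zero.1 h]

end Code

section Pairs

variable {F V : Type*} [Field F] [AddCommGroup V] [Module F V]

theorem linearIndependent_pair_of_isAlt {B : V →ₗ[F] V →ₗ[F] F} (hB : B.IsAlt) {u v : V}
    (huv : B u v ≠ 0) : LinearIndependent F ![u, v] := by
  refine linearIndependent_pair_of_notMem (by rintro rfl; simp at huv) fun h => huv ?_
  obtain ⟨c, rfl⟩ := Submodule.mem_span_singleton.1 h
  rw [map_smul, hB, smul_zero]

theorem eq_span_pair_of_finrank_eq_two {X : Submodule F V} (hX : finrank F X = 2) {u v : V}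
    (hu : u ∈ X) (hv : v ∈ X) (huv : LinearIndependent F ![u, v]) :
    X = Submodule.span F {u, v} := by
  have : FiniteDimensional F X := FiniteDimensional.of_finrank_pos (by lia)
  refine (Submodule.eq_of_le_of_finrank_eq (Submodule.span_le.2 ?_) ?_).symm
  · rintro x (rfl | rfl) <;> assumption
  · rw [finrank_span_pair huv, hX]

variable [Finite V] {q : ℕ}

theorem ncard_setOf_linearIndependent_pair (σ : F →+* F) [IsFrobeniusInvolution q σ] {S : Set V}
    {T : V → Set V} {c : ℤ} (hS : 0 ∈ S) (hspan : ∀ u ∈ S, ((F ∙ u : Submodule F V) : Set V) ⊆ T u)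
    (hT : ∀ u ∈ S, u ≠ 0 → ((T u).ncard : ℤ) = c) :
    ({p : V × V | p.1 ∈ S ∧ p.2 ∈ T p.1 ∧ LinearIndependent F ![p.1, p.2]}.ncard : ℤ) =
      (S.ncard - 1) * (c - q ^ 2) := by
  rw [ncard_setOf_prod_eq_mul (r := fun u v => u ∈ S ∧ v ∈ T u ∧ LinearIndependent F ![u, v])
    (S := S \ {0}) (c := c - q ^ 2) (fun u v h => ⟨h.1, by simpa using h.2.2.ne_zero 0⟩)]
  · rw [← Set.ncard_sdiff_singleton_add_one hS]
    push_cast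
    ring
  · rintro u ⟨hu, hu₀⟩
    have hfibre : {v | u ∈ S ∧ v ∈ T u ∧ LinearIndependent F ![u, v]} =
        T u \ (F ∙ u : Submodule F V) := by
      ext v
      simp [hu, LinearIndependent.pair_iff' hu₀, Submodule.mem_span_singleton]
    have hcard := Set.ncard_sdiff_add_ncard_of_subset (hspan u hu)
    rw [IsFrobeniusInvolution.ncard_submodule σ, finrank_span_singleton hu₀] at hcard
    rw [hfibre, ← hT u hu hu₀, ← hcard]
    push_cast
    ring

theorem ncard_setOf_basis (σ : F →+* F) [IsFrobeniusInvolution q σ] {X : Submodule F V}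
    (hX : finrank F X = 2) :
    ({p : V × V | p.1 ∈ X ∧ p.2 ∈ X ∧ LinearIndependent F ![p.1, p.2]}.ncard : ℤ) =
      (q ^ 4 - 1) * (q ^ 4 - q ^ 2) := by
  have hcard : ((X : Set V).ncard : ℤ) = q ^ 4 := by
    rw [IsFrobeniusInvolution.ncard_submodule σ, hX, Nat.cast_pow]
  have h := ncard_setOf_linearIndependent_pair σ (S := X) (T := fun _ => X) X.zero_mem
    (fun u hu => (Submodule.span_singleton_le_iff_mem u X).2 hu) fun _ _ _ => hcard
  rwa [hcard] at h

theorem ncard_setOf_basis_mem (σ : F →+* F) [IsFrobeniusInvolution q σ]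
    (Q : Set {X : Submodule F V // finrank F X = 2}) :
    ({p : V × V | ∃ X ∈ Q, p.1 ∈ X.1 ∧ p.2 ∈ X.1 ∧ LinearIndependent F ![p.1, p.2]}.ncard : ℤ) =
      Q.ncard * ((q ^ 4 - 1) * (q ^ 4 - q ^ 2)) := by
  let r (X : {X : Submodule F V // finrank F X = 2}) (p : V × V) : Prop :=
    X ∈ Q ∧ p.1 ∈ X.1 ∧ p.2 ∈ X.1 ∧ LinearIndependent F ![p.1, p.2]
  have hunion : {p : V × V | ∃ X ∈ Q, p.1 ∈ X.1 ∧ p.2 ∈ X.1 ∧ LinearIndependent F ![p.1, p.2]} =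
      Prod.snd '' {x | r x.1 x.2} := by
    ext p
    simp [r]
  have hinj : Set.InjOn Prod.snd {x | r x.1 x.2} := by
    rintro ⟨X, p⟩ ⟨-, hX⟩ ⟨Y, p'⟩ ⟨-, hY⟩ rfl
    refine Prod.ext (Subtype.ext ?_) rfl
    exact (eq_span_pair_of_finrank_eq_two X.2 hX.1 hX.2.1 hX.2.2).trans
      (eq_span_pair_of_finrank_eq_two Y.2 hY.1 hY.2.1 hY.2.2).symm
  rw [hunion, hinj.ncard_image, ncard_setOf_prod_eq_mul fun _ _ h => h.1]
  intro X hX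
  simp only [r, hX, true_and]
  exact ncard_setOf_basis σ X.2

end Pairs

section Lines

variable {F V : Type*} [Field F] [AddCommGroup V] [Module F V]
  {σ : F →+* F} {η : V →ₛₗ[σ] V →ₗ[F] F}

theorem exists_isotropicLine_iff (hη : η.IsRefl) {u v : V} (huv : LinearIndependent F ![u, v]) :
    (∃ X ∈ isotropicLines η, u ∈ X.1 ∧ v ∈ X.1) ↔ η u u = 0 ∧ η v v = 0 ∧ η u v = 0 := by
  refine ⟨fun ⟨_, hX, hu, hv⟩ => ⟨hX u hu u hu, hX v hv v hv, hX u hu v hv⟩,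
    fun ⟨huu, hvv, huv₀⟩ => ⟨⟨Submodule.span F {u, v}, finrank_span_pair huv⟩, ?_,
      Submodule.subset_span (by simp), Submodule.subset_span (by simp)⟩⟩
  intro x hx y hy
  obtain ⟨a, b, rfl⟩ := Submodule.mem_span_pair.1 hx
  obtain ⟨c, d, rfl⟩ := Submodule.mem_span_pair.1 hy
  simp [huu, hvv, huv₀, hη u v huv₀]

theorem setOf_basis_isotropicLine (hη : η.IsRefl) :
    {p : V × V | ∃ X ∈ isotropicLines η, p.1 ∈ X.1 ∧ p.2 ∈ X.1 ∧ LinearIndependent F ![p.1, p.2]} =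
      {p | p.1 ∈ isotropicVectors η ⊤ ∧
        p.2 ∈ isotropicVectors η ((F ∙ p.1).orthogonalBilin η) ∧
        LinearIndependent F ![p.1, p.2]} := by
  ext ⟨u, v⟩
  by_cases h : LinearIndependent F ![u, v]
  · simp only [Set.mem_ofPred_eq, h, and_true, isotropicVectors,
      mem_orthogonalBilin_span_singleton, Submodule.mem_top, true_and]
    exact (exists_isotropicLine_iff hη h).trans (by tauto)
  · simp [h]

theorem activePairs_eq_setOf_basis [FiniteDimensional F V] [RingHomInvPair σ σ] (hη : η.IsRefl)
    {f : V →ₛₗ[σ] V} {φ : Dual F (⋀[F]^2 V)}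
    (hf : η.comp f = formOf φ) :
    activePairs η f = {p : V × V | ∃ X ∈ {X ∈ isotropicLines η |
      ¬ (pluecker 2 X).submodule ≤ LinearMap.ker φ},
        p.1 ∈ X.1 ∧ p.2 ∈ X.1 ∧ LinearIndependent F ![p.1, p.2]} := by
  have hφ (u v : V) : η (f u) v = formOf φ u v := LinearMap.congr_fun₂ hf u v
  ext ⟨u, v⟩
  constructor
  · rintro ⟨huu, hvv, huv, hfuv⟩
    rw [hφ] at hfuv
    have hli := linearIndependent_pair_of_isAlt (isAlt_formOf φ) hfuv
    obtain ⟨X, hX, hu, hv⟩ := (exists_isotropicLine_iff hη hli).2 ⟨huu, hvv, huv⟩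
    exact ⟨X, ⟨hX, mt (pluecker_submodule_le_ker_iff X hu hv hli φ).1 hfuv⟩, hu, hv, hli⟩
  · rintro ⟨X, ⟨hX, hXφ⟩, hu, hv, hli⟩
    refine ⟨hX u hu u hu, hX v hv v hv, hX u hu v hv, ?_⟩
    rw [hφ]
    exact mt (pluecker_submodule_le_ker_iff X hu hv hli φ).2 hXφ

variable [Finite V] {q n : ℕ} [IsFrobeniusInvolution q σ]

theorem ncard_isotropicLines_mul (hη : η.IsSymm) (hnd : η.SeparatingLeft)
    (hV : finrank F V = n + 4) :
    ((isotropicLines η).ncard : ℤ) * ((q ^ 4 - 1) * (q ^ 4 - q ^ 2)) =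
      (q ^ (2 * n + 7) + (-1) ^ n * (q - 1) * q ^ (n + 3) - 1) *
      (q ^ (2 * n + 5) + (-1) ^ n * (q - 1) * q ^ (n + 3) - q ^ 2) := by
  rw [← ncard_setOf_basis_mem σ, setOf_basis_isotropicLine hη.isRefl,
    ncard_setOf_linearIndependent_pair σ (S := isotropicVectors η ⊤)
      (T := fun u => isotropicVectors η ((F ∙ u).orthogonalBilin η)) ⟨trivial, by simp⟩ ?_
      fun u hu hu₀ => ncard_isotropicVectors_orthogonalBilin_singleton hη hnd hV hu₀ hu.2,
    ncard_isotropicVectors_top hη hnd hV]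
  · ring
  · rintro u ⟨-, huu⟩ v hv
    obtain ⟨c, rfl⟩ := Submodule.mem_span_singleton.1 hv
    exact ⟨mem_orthogonalBilin_span_singleton.2 (by simp [huu]), by simp [huu]⟩

theorem ncard_isotropicLines_mul_eq_scaledWeight (hη : η.IsSymm) (hnd : η.SeparatingLeft)
    {f : V →ₛₗ[σ] V} {φ : Dual F (⋀[F]^2 V)} (hf : η.comp f = formOf φ)
    (hV : finrank F V = n + 4) :
    ({X ∈ isotropicLines η | ¬ (pluecker 2 X).submodule ≤ LinearMap.ker φ}.ncard : ℤ) *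
      (q ^ 4 - 1) = scaledWeight η f q n := by
  have hpairs := ncard_activePairs hη hnd (hf ▸ isAlt_formOf φ) hV
  rw [activePairs_eq_setOf_basis hη.isRefl hf, ncard_setOf_basis_mem σ] at hpairs
  have hq : (2 : ℤ) ≤ q := by exact_mod_cast IsFrobeniusInvolution.two_le σ
  refine mul_left_cancel₀ (a := ((q : ℤ) ^ 2 - 1) * q ^ 2) ?_ ?_
  · exact mul_ne_zero (by nlinarith) (by positivity)
  · linear_combination hpairs

end Lines

section Parameters

variable {F V : Type*} [Field F] [AddCommGroup V] [Module F V] {σ : F →+* F}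
  {η : V →ₛₗ[σ] V →ₗ[F] F} {N : ℕ} {ω : Fin N → ⋀[F]^2 V}

theorem ncard_isotropicLines_eq [FiniteDimensional F V]
    (hω : IsRepresentativeSystem (hermitianLineVariety η) ω) : (isotropicLines η).ncard = N := by
  rw [← hω.ncard_eq, hermitianLineVariety, Set.ncard_image_of_injective _ pluecker_injective]

variable [Finite V] {q n : ℕ} [IsFrobeniusInvolution q σ]

theorem length_eq (hη : η.IsSymm) (hnd : η.SeparatingLeft) (hV : finrank F V = n + 4)
    (hω : IsRepresentativeSystem (hermitianLineVariety η) ω) :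
    (N : ℚ) = (((q : ℚ) ^ (n + 4) + (-1) ^ (n + 3)) * ((q : ℚ) ^ (n + 3) - (-1) ^ (n + 3)) *
        ((q : ℚ) ^ (n + 2) + (-1) ^ (n + 1)) * ((q : ℚ) ^ (n + 1) - (-1) ^ (n + 1))) /
      (((q : ℚ) ^ 2 - 1) ^ 2 * ((q : ℚ) ^ 2 + 1)) := by
  have hq : (2 : ℚ) ≤ q := by exact_mod_cast IsFrobeniusInvolution.two_le σ
  have hq₁ : (q : ℚ) ^ 2 - 1 ≠ 0 := by nlinarith
  have hN := ncard_isotropicLines_mul hη hnd hV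
  rw [ncard_isotropicLines_eq hω] at hN
  have hN' : (N : ℚ) * ((q ^ 4 - 1) * (q ^ 4 - q ^ 2)) =
      (q ^ (2 * n + 7) + (-1) ^ n * (q - 1) * q ^ (n + 3) - 1) *
      (q ^ (2 * n + 5) + (-1) ^ n * (q - 1) * q ^ (n + 3) - q ^ 2) := by exact_mod_cast hN
  rw [eq_div_iff (by positivity)]
  refine mul_right_cancel₀ (pow_ne_zero 2 (by positivity : (q : ℚ) ≠ 0)) ?_
  rcases neg_one_pow_eq_or ℚ n with h | h
  all_goals
    simp only [pow_succ (-1 : ℚ), h] at hN' ⊢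
    linear_combination hN'

theorem ncard_setOf_apply_ne_zero_mul (hη : η.IsSymm) (hnd : η.SeparatingLeft)
    (hV : finrank F V = n + 4) (hω : IsRepresentativeSystem (hermitianLineVariety η) ω)
    {f : V →ₛₗ[σ] V} {φ : Dual F (⋀[F]^2 V)} (hf : η.comp f = formOf φ) :
    ({i | φ (ω i) ≠ 0}.ncard : ℤ) * (q ^ 4 - 1) = scaledWeight η f q n := by
  rw [← ncard_isotropicLines_mul_eq_scaledWeight hη hnd hf hV, hω.ncard_setOf_apply_ne_zero,
    ← Set.ncard_image_of_injective _ pluecker_injective]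
  congr 3
  exact (Set.image_inter_preimage ..).symm

theorem minDist_pos {q : ℕ} (hq : 1 < q) (n : ℕ) : 0 < minDist q n := by
  have hq' : (1 : ℤ) < q := by exact_mod_cast hq
  rw [minDist, genericMinDist]
  split_ifs
  · exact sub_pos.2 (pow_lt_pow_right₀ hq' (by lia))
  · positivity
  · exact sub_pos.2 (pow_lt_pow_right₀ hq' (by lia))

theorem minDist_le_ncard (hη : η.IsSymm) (hnd : η.SeparatingLeft) (hV : finrank F V = n + 4)
    (hω : IsRepresentativeSystem (hermitianLineVariety η) ω) {φ : Dual F (⋀[F]^2 V)}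
    (hφ : φ ≠ 0) : minDist q n ≤ {i | φ (ω i) ≠ 0}.ncard := by
  have hq : (1 : ℤ) < q := by exact_mod_cast IsFrobeniusInvolution.two_le σ
  obtain ⟨f, hf⟩ := exists_comp_eq hnd (formOf φ)
  have hf₀ : f ≠ 0 := by
    rintro rfl
    exact hφ (formOf_injective (hf.symm.trans (LinearMap.comp_zero η)))
  have hle := minDist_mul_le_scaledWeight hη hnd (hf ▸ isAlt_formOf φ) hV hf₀
  rw [← ncard_setOf_apply_ne_zero_mul hη hnd hV hω hf] at hle
  exact le_of_mul_le_mul_right hle (sub_pos.2 (one_lt_pow₀ hq four_ne_zero))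

theorem exists_ncard_eq_minDist (hη : η.IsSymm) (hnd : η.SeparatingLeft)
    (hV : finrank F V = n + 4) (hω : IsRepresentativeSystem (hermitianLineVariety η) ω) :
    ∃ φ : Dual F (⋀[F]^2 V), ({i | φ (ω i) ≠ 0}.ncard : ℤ) = minDist q n := by
  have hq : (1 : ℤ) < q := by exact_mod_cast IsFrobeniusInvolution.two_le σ
  obtain ⟨f, hf₀, hf, hle⟩ := exists_scaledWeight_le hη hnd hV
  obtain ⟨φ, hφ⟩ := exists_formOf_eq hf
  have hge := minDist_mul_le_scaledWeight hη hnd hf hV hf₀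
  refine ⟨φ, mul_right_cancel₀ (sub_pos.2 (one_lt_pow₀ hq four_ne_zero)).ne' ?_⟩
  rw [ncard_setOf_apply_ne_zero_mul hη hnd hV hω hφ.symm]
  exact le_antisymm hle hge

theorem finrank_hermitianLineCode {q : ℕ} [IsFrobeniusInvolution q σ] (hη : η.IsSymm)
    (hnd : η.SeparatingLeft) (hV : finrank F V = n + 4)
    (hω : IsRepresentativeSystem (hermitianLineVariety η) ω) :
    finrank F (projectiveCode (F := F) ω) = (n + 4).choose 2 := by
  rw [finrank_projectiveCode, exteriorPower.finrank_eq, hV]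
  intro φ hφ
  by_contra hφ₀
  have hle := minDist_le_ncard hη hnd hV hω hφ₀
  simp only [hφ, ne_eq, not_true_eq_false, Set.ofPred_false, Set.ncard_empty, Nat.cast_zero] at hle
  exact hle.not_gt (minDist_pos (IsFrobeniusInvolution.two_le σ) n)

theorem isMinimumDistance_hermitianLineCode [DecidableEq F] (hη : η.IsSymm)
    (hnd : η.SeparatingLeft) (hV : finrank F V = n + 4)
    (hω : IsRepresentativeSystem (hermitianLineVariety η) ω) {d : ℕ} (hd : (d : ℤ) = minDist q n) :
    IsMinimumDistance (projectiveCode (F := F) ω) d := by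
  have hpos := minDist_pos (IsFrobeniusInvolution.two_le σ) n
  refine isMinimumDistance_projectiveCode (by lia) (fun φ hφ => ?_) ?_
  · exact_mod_cast hd.trans_le (minDist_le_ncard hη hnd hV hω hφ)
  · obtain ⟨φ, hφ⟩ := exists_ncard_eq_minDist hη hnd hV hω
    exact ⟨φ, by exact_mod_cast hφ.trans hd.symm⟩

end Parameters

end HermitianGrassmann

open HermitianGrassmann in
theorem mainTheorem1 {F V : Type*} [Field F] [Finite F] [DecidableEq F]
    [AddCommGroup V] [Module F V] [FiniteDimensional F V]
    (q m : ℕ) (hF : Nat.card F = q ^ 2) (hV : Module.finrank F V = m) (hm : 4 ≤ m)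
    -- `σ` is the involution `x ↦ x ^ q` of the field with `q ^ 2` elements
    (σ : F →+* F) (hσ : ∀ x, σ x = x ^ q)
    -- `η` is a non-degenerate Hermitian form
    (η : V →ₛₗ[σ] V →ₗ[F] F) (hη : η.IsSymm) (hnd : η.Nondegenerate)
    -- vector representatives of the points of the projective system, in any order
    (N : ℕ) (ω : Fin N → ⋀[F]^2 V)
    (hω : IsRepresentativeSystem (hermitianLineVariety η) ω) :
    N = Nat.card (isotropicLines η) ∧
    (N : ℚ) =
      (((q : ℚ) ^ m + (-1) ^ (m - 1)) * ((q : ℚ) ^ (m - 1) - (-1) ^ (m - 1)) *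
        ((q : ℚ) ^ (m - 2) + (-1) ^ (m - 3)) * ((q : ℚ) ^ (m - 3) - (-1) ^ (m - 3))) /
      (((q : ℚ) ^ 2 - 1) ^ 2 * ((q : ℚ) ^ 2 + 1)) ∧
    Module.finrank F (projectiveCode (F := F) ω) = m.choose 2 ∧
    (m = 4 ∨ m = 6 →
      IsMinimumDistance (projectiveCode (F := F) ω) (q ^ (4 * m - 12) - q ^ (2 * m - 6))) ∧
    (8 ≤ m → Even m →
      IsMinimumDistance (projectiveCode (F := F) ω) (q ^ (4 * m - 12))) ∧
    (Odd m →
      IsMinimumDistance (projectiveCode (F := F) ω) (q ^ (4 * m - 12) - q ^ (3 * m - 9))) := by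
  obtain ⟨n, rfl⟩ : ∃ n, m = n + 4 := ⟨m - 4, by lia⟩
  have : Finite V := Module.finite_of_finite F
  have : IsFrobeniusInvolution q σ := ⟨hF, hσ⟩
  have hq : 1 ≤ q := one_le_two.trans (IsFrobeniusInvolution.two_le σ)
  have hd {d : ℕ} (hd : (d : ℤ) = minDist q n) :=
    isMinimumDistance_hermitianLineCode hη hnd.1 hV hω hd
  have h₄ : 4 * (n + 4) - 12 = 4 * n + 4 := by lia
  have h₂ : 2 * (n + 4) - 6 = 2 * n + 2 := by lia
  have h₃ : 3 * (n + 4) - 9 = 3 * n + 3 := by lia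
  rw [h₄, h₂, h₃]
  refine ⟨(ncard_isotropicLines_eq hω).symm, length_eq hη hnd.1 hV hω,
    finrank_hermitianLineCode hη hnd.1 hV hω, fun hn => hd ?_, fun hm hn => hd ?_, fun hn => hd ?_⟩
  · rw [minDist_of_eq_zero_or_eq_two (by lia), Nat.cast_sub (Nat.pow_le_pow_right hq (by lia)),
      Nat.cast_pow, Nat.cast_pow]
  · rw [minDist_of_not (by lia), genericMinDist_of_even (by simpa [parity_simps] using hn),
      Nat.cast_pow]
  · rw [minDist_of_not (by grind), genericMinDist_of_odd (by grind),
      Nat.cast_sub (Nat.pow_le_pow_right hq (by lia)), Nat.cast_pow, Nat.cast_pow]
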